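/- Let $\tau$ be a complex number with $\operatorname{Im}\tau>0$, put $q=e^{2\pi i\tau}$ (so $0<|q|<1$), and for rational $r$ write $q^r=e^{2\pi i r\tau}$. For $|p|<1$ let $(a;p)_n=\prod_{k=0}^{n-1}(1-ap^k)$, $(a;p)_\infty=\prod_{k\ge 0}(1-ap^k)$ and $(a_1,\dots,a_m;p)_\infty=(a_1;p)_\infty\cdots(a_m;p)_\infty$. Put $J_m=(q^m;q^m)_\infty$, $J_{a,m}=(q^a,q^{m-a},q^m;q^m)_\infty$, and $$F(u,v,w,t;q^2)=\sum_{i,j,k,l\ge 0}\frac{u^iv^jw^kt^l\,q^{i^2+j^2+k^2+l^2-il-jl-kl}}{(q^2;q^2)_i(q^2;q^2)_j(q^2;q^2)_k(q^2;q^2)_l}.$$ Then this series converges absolutely for all complex $u,v,w,t$, and the following hold. 1. For every $b\in\mathbb{Q}$, $$F(q^{b},q^{-b},1,1;q^2)=\frac{J_{2}^{3}(-q^{1-b},-q^{1+b};q^2)_{\infty}(-q^{2+b},-q^{2-b};q^4)_{\infty}}{J_{1}^{2}J_{4}}+2q\frac{J_{4}^{3}(-q^{-b},-q^{2+b};q^2)_{\infty}(-q^{b},-q^{4-b};q^4)_{\infty}}{J_{2}^{3}}.$$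 2. $$F(q^{-1},q,q,1;q^2)=2\frac{J_{4}^{9}}{J_{2}^{7}J_{8}^{2}}+\frac{J_{2}^{7}J_{8}^{2}}{J_{1}^{4}J_{4}^{5}}.$$ 3. $$F(q,q^{-1},1,q^{1/2};q^2)=2\frac{J_{4}J_{5,12}}{J_{1}^{2}}+2q^{1/2}\frac{J_{2}^{3}J_{2,12}}{J_{1}^{3}J_{4}}-2q\frac{J_{4}J_{1,12}}{J_{1}^{2}}.$$ 4. $$F(1,1,q^{-1},q^{1/2};q^2)=2\frac{J_2^3J_6^2}{J_1^3J_4J_{12}}+4q^{1/2}\frac{J_3J_4J_{12}}{J_1^2J_6}.$$ 5. $$F(1,1,q^{-1},1;q^2)=8\frac{J_{2}^{3}}{J_{1}^{3}}.$$ -/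

import Mathlib

open scoped UpperHalfPlane

noncomputable section

/-- `qPow τ r` is `q ^ r = exp (2 π i r τ)` where `q = exp (2 π i τ)`: the rational powers of `q`
are taken with respect to one fixed logarithm `2 π i τ` of `q`. -/
def qPow (τ : ℍ) (r : ℚ) : ℂ :=
  Complex.exp (2 * (Real.pi : ℂ) * Complex.I * (r : ℂ) * (τ : ℂ))

/-- The finite product `(a; q)_n = ∏_{k = 0}^{n - 1} (1 - a q ^ k)`. -/
def qPoch (a q : ℂ) (n : ℕ) : ℂ := ∏ k ∈ Finset.range n, (1 - a * q ^ k)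

/-- The infinite product `(a; q)_∞ = ∏_{k ≥ 0} (1 - a q ^ k)`. -/
def qPochInf (a q : ℂ) : ℂ := ∏' k : ℕ, (1 - a * q ^ k)

/-- The product `(a; q)_∞` converges whenever `|q| < 1`. -/
theorem multipliable_qPochInf (a q : ℂ) (hq : ‖q‖ < 1) :
    Multipliable fun k : ℕ => 1 - a * q ^ k := by
  have h : Summable fun k : ℕ => ‖-(a * q ^ k)‖ := by
    simpa [norm_mul] using (summable_geometric_of_lt_one (norm_nonneg q) hq).mul_left ‖a‖
  simpa [sub_eq_add_neg] using multipliable_one_add_of_summable h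

/-- `J_m = (q ^ m; q ^ m)_∞`. -/
def qJ (q : ℂ) (m : ℕ) : ℂ := qPochInf (q ^ m) (q ^ m)

/-- `J_{a, m} = (q ^ a, q ^ (m - a), q ^ m; q ^ m)_∞`. -/
def qJ₂ (q : ℂ) (a m : ℕ) : ℂ :=
  qPochInf (q ^ a) (q ^ m) * qPochInf (q ^ ((m : ℤ) - (a : ℤ))) (q ^ m) * qPochInf (q ^ m) (q ^ m)

/-- The general term, with index `n = (i, j, k, l)`, of the series `F(u, v, w, t; q ^ 2)`. -/
def nahmTerm (u v w t q : ℂ) (n : ℕ × ℕ × ℕ × ℕ) : ℂ :=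
  match n with
  | (i, j, k, l) =>
    u ^ i * v ^ j * w ^ k * t ^ l *
        q ^ ((i : ℤ) ^ 2 + (j : ℤ) ^ 2 + (k : ℤ) ^ 2 + (l : ℤ) ^ 2
              - (i : ℤ) * l - (j : ℤ) * l - (k : ℤ) * l) /
      (qPoch (q ^ 2) (q ^ 2) i * qPoch (q ^ 2) (q ^ 2) j *
        qPoch (q ^ 2) (q ^ 2) k * qPoch (q ^ 2) (q ^ 2) l)

/-- The series `F(u, v, w, t; q ^ 2)`, as a function of `u, v, w, t` and `q`. -/
def nahmF (u v w t q : ℂ) : ℂ := ∑' n : ℕ × ℕ × ℕ × ℕ, nahmTerm u v w t q n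

end

open Filter Topology

noncomputable section

/-! ### Finite and infinite `q`-shifted factorials -/

/-! Write p = q^2. In the quadratic form the index l is coupled to each of i, j, k, while i, j, k
are not coupled to one another. For fixed l the inner triple sum is therefore a product of three
Euler series, and F becomes the single sum over l of t^l q^(l^2) / (p; p)_l times the products (-x
q^(1-l); p)_∞ for x = u, v, w. Putting l = 2n + δ with δ = 0, 1 and reversing the finitely many
factors with nonpositive shifts leaves two series in n, containing (-q^(1+δ)/x; p)_n for the three
x, and 1 / (p; p)_(2n+δ) (`nahmF_eq_add`).

Two of the three finite products, divided by (p; p)_(2n+δ), form one half of a Bailey pair: they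
equal a finite bilateral sum of c_r / ((p; p)_(n-r) (p; p)_(n+δ+r)). When u v = 1 and t = 1 this is
the finite Jacobi triple product (`bilatSum_triple`, `bilatSum_triple_odd`), with c_r = u^r
q^(r^2+δr). When two of the parameters are q^(-1) and 1 and t^2 = q, the quotient is 1 / (q;
q)_(2n+δ) up to a constant, and c_r = q^(2r^2+r) (`bilatSum_triangular`, `bilatSum_triangular_odd`).

The third finite product serves as a weight. After interchanging the sums, the sum over n is a `₁φ₁`
series with a closed form (`tsum_phiTerm`, `baileySum_natCast`). For third parameter 1, q or q^(-1)
what remains is a theta series in r, which the Jacobi triple product (`tsum_zpow_mul_zpow_sq`) turns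
into infinite products and then eta quotients. The third evaluation also needs the splitting of a
theta series into even and odd r (`thetaSeries_sqrt_neg`). -/

theorem qPoch_zero (a q : ℂ) : qPoch a q 0 = 1 := by simp [qPoch]

theorem qPoch_succ (a q : ℂ) (n : ℕ) : qPoch a q (n + 1) = qPoch a q n * (1 - a * q ^ n) := by
  simp [qPoch, Finset.prod_range_succ]

theorem qPoch_add (a q : ℂ) (m n : ℕ) :
    qPoch a q (m + n) = qPoch a q m * qPoch (a * q ^ m) q n := by
  simp only [qPoch, Finset.prod_range_add]
  congr 1
  refine Finset.prod_congr rfl fun k _ => ?_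
  ring

theorem qPoch_succ' (a q : ℂ) (n : ℕ) : qPoch a q (n + 1) = (1 - a) * qPoch (a * q) q n := by
  rw [add_comm, qPoch_add]
  simp [qPoch]

/-- Reversal of a finite product: `(x p⁻ⁿ; p)_n p ^ (n (n + 1) / 2) = (-x)ⁿ (p / x; p)_n`,
for `p = q ^ 2`. -/
theorem qPoch_reverse {q : ℂ} (hq : q ≠ 0) {x : ℂ} (hx : x ≠ 0) (n : ℕ) :
    qPoch (x / (q ^ 2) ^ n) (q ^ 2) n * q ^ (n ^ 2 + n) =
      (-x) ^ n * qPoch (q ^ 2 / x) (q ^ 2) n := by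
  induction n with
  | zero => simp [qPoch_zero]
  | succ n ih =>
    have h1 : x / (q ^ 2) ^ (n + 1) * q ^ 2 = x / (q ^ 2) ^ n := by
      field_simp
      ring
    rw [qPoch_succ', h1, qPoch_succ (q ^ 2 / x), pow_succ (-x)]
    calc _ = (1 - x / (q ^ 2) ^ (n + 1)) * q ^ (2 * n + 2) *
          (qPoch (x / (q ^ 2) ^ n) (q ^ 2) n * q ^ (n ^ 2 + n)) := by ring
      _ = _ := by
        rw [ih]
        field_simp
        ring

/-- The bound does not depend on n, so it passes to the infinite product and shows that (x; q)_∞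
tends to 1 as x tends to 0. -/
theorem norm_qPoch_sub_one_le {q : ℂ} (hq : ‖q‖ < 1) (a : ℂ) (n : ℕ) :
    ‖qPoch a q n - 1‖ ≤ Real.exp (‖a‖ / (1 - ‖q‖)) - 1 := by
  have h := Finset.norm_prod_one_add_sub_one_le (Finset.range n) fun k => -(a * q ^ k)
  simp only [← sub_eq_add_neg] at h
  refine h.trans (sub_le_sub_right (Real.exp_le_exp.mpr ?_) 1)
  simp only [norm_neg, norm_mul, norm_pow]
  rw [← Finset.mul_sum, div_eq_mul_inv, ← tsum_geometric_of_lt_one (norm_nonneg q) hq]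
  exact mul_le_mul_of_nonneg_left
    ((summable_geometric_of_lt_one (norm_nonneg q) hq).sum_le_tsum _ fun _ _ => by positivity)
    (norm_nonneg a)

theorem tendsto_qPoch {q : ℂ} (hq : ‖q‖ < 1) (a : ℂ) :
    Tendsto (qPoch a q) atTop (𝓝 (qPochInf a q)) :=
  (multipliable_qPochInf a q hq).tendsto_prod_tprod_nat

theorem norm_qPochInf_sub_one_le {q : ℂ} (hq : ‖q‖ < 1) (a : ℂ) :
    ‖qPochInf a q - 1‖ ≤ Real.exp (‖a‖ / (1 - ‖q‖)) - 1 :=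
  le_of_tendsto ((tendsto_qPoch hq a).sub_const 1).norm
    (Eventually.of_forall (norm_qPoch_sub_one_le hq a))

theorem norm_qPoch_le {q : ℂ} (hq : ‖q‖ < 1) (a : ℂ) (n : ℕ) :
    ‖qPoch a q n‖ ≤ Real.exp (‖a‖ / (1 - ‖q‖)) := by
  have h := norm_qPoch_sub_one_le hq a n
  have h2 := norm_add_le (qPoch a q n - 1) 1
  simp only [sub_add_cancel, norm_one] at h2
  linarith

theorem norm_qPochInf_le {q : ℂ} (hq : ‖q‖ < 1) {a : ℂ} {R : ℝ} (ha : ‖a‖ ≤ R) :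
    ‖qPochInf a q‖ ≤ Real.exp (R / (1 - ‖q‖)) := by
  have h : ‖qPochInf a q‖ ≤ Real.exp (‖a‖ / (1 - ‖q‖)) :=
    le_of_tendsto (tendsto_qPoch hq a).norm (Eventually.of_forall (norm_qPoch_le hq a))
  have : 0 < 1 - ‖q‖ := by linarith
  exact h.trans (Real.exp_le_exp.mpr (by gcongr))

theorem tendsto_qPochInf_one {q : ℂ} (hq : ‖q‖ < 1) {x : ℕ → ℂ} (hx : Tendsto x atTop (𝓝 0)) :
    Tendsto (fun n => qPochInf (x n) q) atTop (𝓝 1) := by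
  rw [tendsto_iff_norm_sub_tendsto_zero]
  refine squeeze_zero (fun _ => norm_nonneg _) (fun n => norm_qPochInf_sub_one_le hq (x n)) ?_
  have h := ((Real.continuous_exp.tendsto _).comp (hx.norm.div_const (1 - ‖q‖))).sub_const 1
  simpa using h

theorem qPochInf_eq {q : ℂ} (hq : ‖q‖ < 1) (a : ℂ) (n : ℕ) :
    qPochInf a q = qPoch a q n * qPochInf (a * q ^ n) q := by
  refine tendsto_nhds_unique ((tendsto_qPoch hq a).comp (tendsto_add_atTop_nat n)) ?_
  have h := (tendsto_qPoch hq (a * q ^ n)).const_mul (qPoch a q n)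
  refine h.congr fun m => ?_
  rw [← qPoch_add, add_comm]; rfl

theorem qPochInf_succ {q : ℂ} (hq : ‖q‖ < 1) (a : ℂ) :
    qPochInf a q = (1 - a) * qPochInf (a * q) q := by
  simpa [qPoch] using qPochInf_eq hq a 1

theorem qPochInf_zero (q : ℂ) : qPochInf 0 q = 1 := by simp [qPochInf]

theorem qPochInf_ne_zero {a q : ℂ} (hq : ‖q‖ < 1) (h : ∀ k : ℕ, 1 - a * q ^ k ≠ 0) :
    qPochInf a q ≠ 0 := by
  have hs : Summable fun k : ℕ => ‖-(a * q ^ k)‖ := by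
    simpa [norm_mul] using (summable_geometric_of_lt_one (norm_nonneg q) hq).mul_left ‖a‖
  have := tprod_one_add_ne_zero_of_summable (f := fun k : ℕ => -(a * q ^ k))
    (by simpa [← sub_eq_add_neg] using h) hs
  simpa [qPochInf, ← sub_eq_add_neg] using this

theorem one_sub_ne_zero_of_norm {x : ℂ} (hx : ‖x‖ < 1) : 1 - x ≠ 0 := by
  intro h
  rw [← sub_eq_zero.mp h, norm_one] at hx
  exact lt_irrefl _ hx

theorem one_add_ne_zero_of_norm {x : ℂ} (hx : ‖x‖ < 1) : 1 + x ≠ 0 := by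
  simpa using one_sub_ne_zero_of_norm (x := -x) (by simpa using hx)

theorem norm_mul_pow_lt_one {a q : ℂ} (hq : ‖q‖ < 1) (ha : ‖a‖ < 1) (k : ℕ) :
    ‖a * q ^ k‖ < 1 := by
  rw [norm_mul, norm_pow]
  exact (mul_le_of_le_one_right (norm_nonneg a) (pow_le_one₀ (norm_nonneg q) hq.le)).trans_lt ha

theorem qPochInf_ne_zero_of_norm {a q : ℂ} (hq : ‖q‖ < 1) (ha : ‖a‖ < 1) :
    qPochInf a q ≠ 0 :=
  qPochInf_ne_zero hq fun k => one_sub_ne_zero_of_norm (norm_mul_pow_lt_one hq ha k)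

theorem qPoch_ne_zero_of_norm {a q : ℂ} (hq : ‖q‖ < 1) (ha : ‖a‖ < 1) (n : ℕ) :
    qPoch a q n ≠ 0 :=
  Finset.prod_ne_zero_iff.mpr fun k _ => one_sub_ne_zero_of_norm (norm_mul_pow_lt_one hq ha k)

theorem norm_pow_lt_one {q : ℂ} (hq : ‖q‖ < 1) {m : ℕ} (hm : m ≠ 0) : ‖q ^ m‖ < 1 := by
  rw [norm_pow]
  exact pow_lt_one₀ (norm_nonneg q) hq hm

/-! ### Product identities for infinite `q`-shifted factorials -/

theorem qPoch_mul_neg (a q : ℂ) (n : ℕ) :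
    qPoch a q n * qPoch (-a) q n = qPoch (a ^ 2) (q ^ 2) n := by
  simp only [qPoch, ← Finset.prod_mul_distrib]
  refine Finset.prod_congr rfl fun k _ => ?_
  ring

theorem qPochInf_mul_neg {q : ℂ} (hq : ‖q‖ < 1) (a : ℂ) :
    qPochInf a q * qPochInf (-a) q = qPochInf (a ^ 2) (q ^ 2) := by
  refine tendsto_nhds_unique ((tendsto_qPoch hq a).mul (tendsto_qPoch hq (-a))) ?_
  simpa only [qPoch_mul_neg] using tendsto_qPoch (norm_pow_lt_one hq two_ne_zero) (a ^ 2)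

theorem qPoch_mul_length (a q : ℂ) (m n : ℕ) :
    qPoch a q (m * n) = ∏ j ∈ Finset.range m, qPoch (a * q ^ j) (q ^ m) n := by
  induction n with
  | zero => simp [qPoch]
  | succ n ih =>
    rw [mul_add, mul_one, qPoch_add, ih]
    simp only [qPoch_succ, Finset.prod_mul_distrib]
    congr 1
    refine Finset.prod_congr rfl fun k _ => ?_
    ring

theorem qPochInf_eq_prod {q : ℂ} (hq : ‖q‖ < 1) (a : ℂ) {m : ℕ} (hm : m ≠ 0) :
    qPochInf a q = ∏ j ∈ Finset.range m, qPochInf (a * q ^ j) (q ^ m) := by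
  have h1 : Tendsto (fun n : ℕ => m * n) atTop atTop :=
    tendsto_id.const_mul_atTop' (Nat.pos_of_ne_zero hm)
  refine tendsto_nhds_unique ((tendsto_qPoch hq a).comp h1) ?_
  have := tendsto_finsetProd (Finset.range m) fun j _ =>
    tendsto_qPoch (norm_pow_lt_one hq hm) (a * q ^ j)
  exact this.congr fun n => (qPoch_mul_length a q m n).symm

/-! ### Reciprocals of `(q ^ 2; q ^ 2)_k` with an integer index -/

/-- `1 / (q ^ 2; q ^ 2)_k`, which is `0` for negative `k`. -/
def qFactInv (q : ℂ) (k : ℤ) : ℂ := if 0 ≤ k then (qPoch (q ^ 2) (q ^ 2) k.toNat)⁻¹ else 0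

theorem qFactInv_natCast (q : ℂ) (n : ℕ) : qFactInv q n = (qPoch (q ^ 2) (q ^ 2) n)⁻¹ := by
  simp [qFactInv]

theorem qFactInv_of_neg (q : ℂ) {k : ℤ} (hk : k < 0) : qFactInv q k = 0 := by
  simp [qFactInv, hk.not_ge]

/-- With the value 0 at negative indices the recurrence holds for every integer k: at k = 0 the
factor 1 - q^0 vanishes. This is why bilateral sums can be shifted without boundary terms. -/
theorem qFactInv_sub_one {q : ℂ} (hq : ‖q‖ < 1) (k : ℤ) :
    qFactInv q (k - 1) = (1 - q ^ (2 * k)) * qFactInv q k := by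
  have h2 := norm_pow_lt_one hq two_ne_zero
  rcases lt_trichotomy k 0 with h | rfl | h
  · rw [qFactInv_of_neg q h, qFactInv_of_neg q (by omega), mul_zero]
  · simp [qFactInv]
  · obtain ⟨n, rfl⟩ : ∃ n : ℕ, k = (n + 1 : ℕ) := ⟨(k - 1).toNat, by omega⟩
    have h1 : ((n + 1 : ℕ) : ℤ) - 1 = (n : ℕ) := by push_cast; ring
    have h3 : q ^ (2 * ((n + 1 : ℕ) : ℤ)) = q ^ 2 * (q ^ 2) ^ n := by
      rw [← Nat.cast_ofNat, ← Nat.cast_mul, zpow_natCast]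
      ring
    rw [h1, qFactInv_natCast, qFactInv_natCast, qPoch_succ, h3]
    have h4 := qPoch_ne_zero_of_norm h2 h2 n
    have h5 := one_sub_ne_zero_of_norm (norm_mul_pow_lt_one h2 h2 n)
    field_simp

theorem tendsto_qFactInv {q : ℂ} (hq : ‖q‖ < 1) :
    Tendsto (fun n : ℕ => qFactInv q n) atTop (𝓝 (qPochInf (q ^ 2) (q ^ 2))⁻¹) := by
  have h2 := norm_pow_lt_one hq two_ne_zero
  simpa only [qFactInv_natCast] using
    (tendsto_qPoch h2 (q ^ 2)).inv₀ (qPochInf_ne_zero_of_norm h2 h2)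

/-- A convergent sequence is bounded. The constant supplies the majorants for all later interchanges
of sums and limits. -/
theorem exists_norm_qFactInv_le {q : ℂ} (hq : ‖q‖ < 1) :
    ∃ C : ℝ, 0 ≤ C ∧ ∀ k : ℤ, ‖qFactInv q k‖ ≤ C := by
  obtain ⟨C, hC⟩ := (Metric.isBounded_range_of_tendsto _ (tendsto_qFactInv hq)).exists_norm_le
  refine ⟨C, (norm_nonneg _).trans (hC _ (Set.mem_range_self 0)), fun k => ?_⟩
  rcases lt_or_ge k 0 with h | h
  · rw [qFactInv_of_neg q h, norm_zero]
    exact (norm_nonneg _).trans (hC _ (Set.mem_range_self 0))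
  · obtain ⟨n, rfl⟩ := Int.eq_ofNat_of_zero_le h
    exact hC _ (Set.mem_range_self n)

theorem qFactInv_natCast_eq {q : ℂ} (hq : ‖q‖ < 1) (n : ℕ) :
    qFactInv q n = qPochInf (q ^ 2 * (q ^ 2) ^ n) (q ^ 2) / qPochInf (q ^ 2) (q ^ 2) := by
  have h2 := norm_pow_lt_one hq two_ne_zero
  have h3 := qPochInf_ne_zero_of_norm h2 (norm_mul_pow_lt_one h2 h2 n)
  have h4 := qPoch_ne_zero_of_norm h2 h2 n
  rw [qFactInv_natCast, qPochInf_eq h2 (q ^ 2) n]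
  field_simp

/-! ### Summability -/

theorem summable_pow_mul_pow_sq (x : ℝ) {s : ℝ} (h0 : 0 ≤ s) (h1 : s < 1) :
    Summable fun n : ℕ => |x| ^ n * s ^ (n ^ 2) := by
  have h : Tendsto (fun n : ℕ => |x| * s ^ n) atTop (𝓝 0) := by
    -- The n-th term is (|x| s^n)^n, whose base eventually drops below 1/2.
    simpa using (tendsto_pow_atTop_nhds_zero_of_lt_one h0 h1).const_mul |x|
  have h2 : ∀ᶠ n : ℕ in atTop, |x| * s ^ n < 1 / 2 := h.eventually_lt_const (by norm_num)
  refine Summable.of_norm_bounded_eventually_nat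
    (summable_geometric_of_lt_one (by norm_num : (0 : ℝ) ≤ 1 / 2) (by norm_num)) ?_
  filter_upwards [h2] with n hn
  rw [Real.norm_of_nonneg (by positivity), pow_two n, pow_mul, ← mul_pow]
  exact pow_le_pow_left₀ (by positivity) hn.le n

theorem summable_norm_pow_mul_pow_sq {q : ℂ} (hq : ‖q‖ < 1) (x : ℂ) :
    Summable fun n : ℕ => ‖x ^ n * q ^ (n ^ 2)‖ := by
  simpa [norm_mul, norm_pow] using summable_pow_mul_pow_sq ‖x‖ (norm_nonneg q) hq

theorem summable_norm_zpow_mul_zpow_sq {q : ℂ} (hq : ‖q‖ < 1) (z : ℂ) :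
    Summable fun r : ℤ => ‖z ^ r * q ^ (r ^ 2)‖ := by
  refine summable_int_iff_summable_nat_and_neg.mpr ⟨?_, ?_⟩
  · refine (summable_norm_pow_mul_pow_sq hq z).congr fun n => ?_
    rw [← Nat.cast_pow, zpow_natCast, zpow_natCast]
  · refine (summable_norm_pow_mul_pow_sq hq z⁻¹).congr fun n => ?_
    rw [neg_sq, ← Nat.cast_pow, zpow_natCast, zpow_neg, zpow_natCast, inv_pow]

/-! ### The `₁φ₁` summation -/

/-- The series `∑ yⁿ q ^ (n²) (a; p)_n (c pⁿ; p)_∞ / (p; p)_n` with `p = q ^ 2`. -/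
def phiTerm (q a y c : ℂ) (n : ℕ) : ℂ :=
  y ^ n * q ^ (n ^ 2) * qFactInv q n * qPoch a (q ^ 2) n * qPochInf (c * (q ^ 2) ^ n) (q ^ 2)

theorem exists_norm_phiTerm_le {q : ℂ} (hq : ‖q‖ < 1) (a : ℂ) (R : ℝ) :
    ∃ C : ℝ, 0 ≤ C ∧ ∀ y c : ℂ, ‖c‖ ≤ R → ∀ n : ℕ,
      ‖phiTerm q a y c n‖ ≤ C * ‖y ^ n * q ^ (n ^ 2)‖ := by
  have h2 := norm_pow_lt_one hq two_ne_zero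
  obtain ⟨C, hC0, hC⟩ := exists_norm_qFactInv_le hq
  refine ⟨C * Real.exp (‖a‖ / (1 - ‖q ^ 2‖)) * Real.exp (R / (1 - ‖q ^ 2‖)), by positivity,
    fun y c hc n => ?_⟩
  have h3 : ‖c * (q ^ 2) ^ n‖ ≤ R := by
    rw [norm_mul, norm_pow _ n]
    exact (mul_le_of_le_one_right (norm_nonneg c)
      (pow_le_one₀ (norm_nonneg _) h2.le)).trans hc
  calc ‖phiTerm q a y c n‖ = ‖y ^ n * q ^ (n ^ 2)‖ * ‖qFactInv q n‖ * ‖qPoch a (q ^ 2) n‖ *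
        ‖qPochInf (c * (q ^ 2) ^ n) (q ^ 2)‖ := by simp only [phiTerm, norm_mul]
    _ ≤ ‖y ^ n * q ^ (n ^ 2)‖ * C * Real.exp (‖a‖ / (1 - ‖q ^ 2‖)) *
        Real.exp (R / (1 - ‖q ^ 2‖)) := by
      gcongr
      · exact hC n
      · exact norm_qPoch_le h2 a n
      · exact norm_qPochInf_le h2 h3
    _ = _ := by ring

theorem summable_phiTerm {q : ℂ} (hq : ‖q‖ < 1) (a y c : ℂ) : Summable (phiTerm q a y c) := by
  obtain ⟨C, _, hC⟩ := exists_norm_phiTerm_le hq a ‖c‖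
  exact Summable.of_norm_bounded ((summable_norm_pow_mul_pow_sq hq y).mul_left C)
    (hC y c le_rfl)

/-- Splits off the first factor 1 - c p^n of (c p^n; p)_∞; the power p^n is absorbed by replacing y
with y p. -/
theorem tsum_phiTerm_contract {q : ℂ} (hq : ‖q‖ < 1) (a y c : ℂ) :
    ∑' n, phiTerm q a y c n =
      ∑' n, phiTerm q a y (c * q ^ 2) n - c * ∑' n, phiTerm q a (y * q ^ 2) (c * q ^ 2) n := by
  have h2 := norm_pow_lt_one hq two_ne_zero
  rw [← tsum_mul_left, ← (summable_phiTerm hq a y _).tsum_sub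
    ((summable_phiTerm hq a _ _).mul_left c)]
  refine tsum_congr fun n => ?_
  rw [phiTerm, phiTerm, phiTerm, qPochInf_succ h2 (c * (q ^ 2) ^ n),
    show c * (q ^ 2) ^ n * q ^ 2 = c * q ^ 2 * (q ^ 2) ^ n by ring, mul_pow]
  ring

/-- The difference of the series at y and y p carries the factor 1 - p^n, which kills the term n = 0
and lowers the index of 1 / (p; p)_n; the factor 1 - a p^n split off from (a; p)_(n+1) gives the
last two series. -/
theorem tsum_phiTerm_sub {q : ℂ} (hq : ‖q‖ < 1) (a y c : ℂ) :
    ∑' n, phiTerm q a y c n = ∑' n, phiTerm q a (y * q ^ 2) c n +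
      y * q * (∑' n, phiTerm q a (y * q ^ 2) (c * q ^ 2) n -
        a * ∑' n, phiTerm q a (y * q ^ 2 * q ^ 2) (c * q ^ 2) n) := by
  have hs := summable_phiTerm hq a
  rw [← sub_eq_iff_eq_add', ← (hs _ _).tsum_sub (hs _ _), ← tsum_mul_left,
    ← (hs _ _).tsum_sub ((hs _ _).mul_left a), ← tsum_mul_left,
    ((hs _ _).sub (hs _ _)).tsum_eq_zero_add]
  have h0 : phiTerm q a y c 0 - phiTerm q a (y * q ^ 2) c 0 = 0 := by simp [phiTerm]
  rw [h0, zero_add]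
  refine tsum_congr fun n => ?_
  have h1 := qFactInv_sub_one hq ((n + 1 : ℕ) : ℤ)
  rw [show ((n + 1 : ℕ) : ℤ) - 1 = (n : ℕ) by push_cast; ring, ← Nat.cast_ofNat, ← Nat.cast_mul,
    zpow_natCast] at h1
  have h3 : c * (q ^ 2) ^ (n + 1) = c * q ^ 2 * (q ^ 2) ^ n := by ring
  calc phiTerm q a y c (n + 1) - phiTerm q a (y * q ^ 2) c (n + 1)
      = y ^ (n + 1) * q ^ ((n + 1) ^ 2) * ((1 - q ^ (2 * (n + 1))) * qFactInv q (n + 1 : ℕ)) *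
        qPoch a (q ^ 2) (n + 1) * qPochInf (c * (q ^ 2) ^ (n + 1)) (q ^ 2) := by
        simp only [phiTerm, mul_pow]; ring
    _ = _ := by
        rw [← h1, h3, qPoch_succ]
        simp only [phiTerm, mul_pow]
        ring

/-- The `₁φ₁` summation, with denominators cleared. -/
theorem tsum_phiTerm {q : ℂ} (hq : ‖q‖ < 1) (a y : ℂ) :
    ∑' n, phiTerm q a y (-a * y * q) n = qPochInf (-y * q) (q ^ 2) := by
  have h2 := norm_pow_lt_one hq two_ne_zero
  have hp := tendsto_pow_atTop_nhds_zero_of_norm_lt_one h2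
  set f : ℂ → ℂ := fun y => ∑' n, phiTerm q a y (-a * y * q) n with hf
  -- `E` is the defect in the expected equation f(y) = (1 + y q) f(y p). The two q-difference
  -- relations give a homogeneous first-order recurrence for `E`, and its iteration forces `E` to
  -- vanish.
  set E : ℂ → ℂ := fun y => f y - (1 + y * q) * f (y * q ^ 2) with hE
  have hrec : ∀ y, E y = a * y * q * E (y * q ^ 2) := by
    intro y
    have e1 := tsum_phiTerm_contract hq a y (-a * y * q)
    have e2 := tsum_phiTerm_contract hq a (y * q ^ 2) (-a * (y * q ^ 2) * q)
    have e3 := tsum_phiTerm_sub hq a y (-a * y * q * q ^ 2)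
    have c1 : -a * (y * q ^ 2) * q = -a * y * q * q ^ 2 := by ring
    have c2 : -a * (y * q ^ 2 * q ^ 2) * q = -a * y * q * q ^ 2 * q ^ 2 := by ring
    simp only [hE, hf, c1, c2] at e1 e2 e3 ⊢
    linear_combination e1 + e3 + y * q * (-e2)
  have hlim : ∀ y, Tendsto (fun N : ℕ => f (y * (q ^ 2) ^ N)) atTop (𝓝 1) := by
    intro y
    have hy : Tendsto (fun N : ℕ => y * (q ^ 2) ^ N) atTop (𝓝 0) := by simpa using hp.const_mul y
    obtain ⟨C, hC0, hC⟩ := exists_norm_phiTerm_le hq a ‖-a * y * q‖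
    have hle : ∀ N : ℕ, ‖(q ^ 2) ^ N‖ ≤ 1 := fun N => by
      rw [norm_pow _ N]; exact pow_le_one₀ (norm_nonneg _) h2.le
    -- As y p^N tends to 0 only the term n = 0 survives, and it tends to 1.
    have key := tendsto_tsum_of_dominated_convergence (𝓕 := atTop)
      (f := fun N n => phiTerm q a (y * (q ^ 2) ^ N) (-a * (y * (q ^ 2) ^ N) * q) n)
      (g := fun n => if n = 0 then 1 else 0) (bound := fun n => C * ‖y ^ n * q ^ (n ^ 2)‖)
      ((summable_norm_pow_mul_pow_sq hq y).mul_left C) ?_ ?_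
    · simpa [hf] using key
    · intro n
      have hc : Tendsto (fun N : ℕ => qPochInf (-a * (y * (q ^ 2) ^ N) * q * (q ^ 2) ^ n) (q ^ 2))
          atTop (𝓝 1) :=
        tendsto_qPochInf_one h2 (by
          simpa using ((hy.const_mul (-a)).mul_const q).mul_const ((q ^ 2) ^ n))
      rcases Nat.eq_zero_or_pos n with rfl | hn
      · simpa [phiTerm, qFactInv, qPoch_zero] using hc
      · have := (((hy.pow n).mul_const (q ^ (n ^ 2))).mul_const (qFactInv q n)).mul_const
          (qPoch a (q ^ 2) n) |>.mul hc
        simpa [phiTerm, hn.ne'] using this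
    · refine Eventually.of_forall fun N n => (hC _ _ ?_ n).trans ?_
      · calc ‖-a * (y * (q ^ 2) ^ N) * q‖ = ‖-a * y * q‖ * ‖(q ^ 2) ^ N‖ := by
              simp only [norm_mul]; ring
          _ ≤ _ := mul_le_of_le_one_right (norm_nonneg _) (hle N)
      · refine mul_le_mul_of_nonneg_left ?_ hC0
        rw [mul_pow, norm_mul, norm_mul, norm_mul, norm_pow (_ ^ N) n]
        exact mul_le_mul_of_nonneg_right (mul_le_of_le_one_right (norm_nonneg _)
          (pow_le_one₀ (norm_nonneg _) (hle N))) (norm_nonneg _)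
  have hEzero : ∀ y, E y = 0 := by
    intro y
    have hEb : Tendsto (fun N : ℕ => E (y * (q ^ 2) ^ N)) atTop (𝓝 0) := by
      have hy : Tendsto (fun N : ℕ => y * (q ^ 2) ^ N) atTop (𝓝 0) := by simpa using hp.const_mul y
      have h := (hlim y).sub (((hy.mul_const q).const_add 1).mul
        (((hlim y).comp (tendsto_add_atTop_nat 1))))
      have e : (1 : ℂ) - (1 + 0 * q) * 1 = 0 := by ring
      rw [e] at h
      refine h.congr fun N => ?_
      simp only [hE, Function.comp, pow_succ, mul_assoc]
    have hstep : ∀ N : ℕ, E y = (∏ k ∈ Finset.range N, (a * q * y * (q ^ 2) ^ k)) *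
        E (y * (q ^ 2) ^ N) := by
      intro N
      induction N with
      | zero => simp
      | succ N ih =>
        rw [ih, Finset.prod_range_succ, hrec (y * (q ^ 2) ^ N), pow_succ (q ^ 2), ← mul_assoc y]
        ring
    -- Since x ≤ exp x, the accumulated multipliers stay bounded for every a and y, while E(y p^N)
    -- tends to 0.
    have hprod : ∀ N : ℕ, ‖∏ k ∈ Finset.range N, (a * q * y * (q ^ 2) ^ k)‖ ≤
        Real.exp (‖a * q * y‖ / (1 - ‖q ^ 2‖)) := by
      intro N
      rw [norm_prod]
      calc _ ≤ ∏ k ∈ Finset.range N, Real.exp (‖a * q * y‖ * ‖q ^ 2‖ ^ k) := by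
            refine Finset.prod_le_prod (fun _ _ => norm_nonneg _) fun k _ => ?_
            rw [norm_mul, norm_pow _ k]
            exact (le_add_of_nonneg_right zero_le_one).trans (Real.add_one_le_exp _)
        _ ≤ _ := by
            rw [← Real.exp_sum, ← Finset.mul_sum, div_eq_mul_inv,
              ← tsum_geometric_of_lt_one (norm_nonneg _) h2]
            exact Real.exp_le_exp.mpr (mul_le_mul_of_nonneg_left
              ((summable_geometric_of_lt_one (norm_nonneg _) h2).sum_le_tsum _
                fun _ _ => by positivity) (norm_nonneg _))
    have h3 := hEb.norm.const_mul (Real.exp (‖a * q * y‖ / (1 - ‖q ^ 2‖)))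
    rw [norm_zero, mul_zero] at h3
    refine norm_le_zero_iff.mp (ge_of_tendsto' h3 fun N => ?_)
    rw [hstep N, norm_mul]
    exact mul_le_mul_of_nonneg_right (hprod N) (norm_nonneg _)
  have hmain : ∀ N : ℕ, f y = qPoch (-y * q) (q ^ 2) N * f (y * (q ^ 2) ^ N) := by
    intro N
    induction N with
    | zero => simp [qPoch_zero]
    | succ N ih =>
      have h := hEzero (y * (q ^ 2) ^ N)
      simp only [hE, sub_eq_zero] at h
      rw [ih, h, qPoch_succ, pow_succ (q ^ 2), ← mul_assoc y]
      ring
  have h := (tendsto_qPoch h2 (-y * q)).mul (hlim y)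
  rw [mul_one] at h
  exact tendsto_nhds_unique (tendsto_const_nhds.congr hmain) h

/-! ### Finite bilateral sums -/

/-- The finite sum `∑ c_r / ((p; p)_{a - r} (p; p)_{b + r})` over all integers `r`, for
`p = q ^ 2`. -/
def bilatSum (q : ℂ) (a b : ℤ) (c : ℤ → ℂ) : ℂ :=
  ∑' r : ℤ, c r * (qFactInv q (a - r) * qFactInv q (b + r))

theorem summable_bilatSum (q : ℂ) (a b : ℤ) (c : ℤ → ℂ) :
    Summable fun r : ℤ => c r * (qFactInv q (a - r) * qFactInv q (b + r)) := by
  refine summable_of_ne_finset_zero (s := Finset.Icc (-b) a) fun r hr => ?_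
  rw [Finset.mem_Icc, not_and_or, not_le, not_le] at hr
  rcases hr with h | h
  · rw [qFactInv_of_neg q (by omega : b + r < 0), mul_zero, mul_zero]
  · rw [qFactInv_of_neg q (by omega : a - r < 0), zero_mul, mul_zero]

theorem bilatSum_add (q : ℂ) (a b : ℤ) (c d : ℤ → ℂ) :
    bilatSum q a b (fun r => c r + d r) = bilatSum q a b c + bilatSum q a b d := by
  simp only [bilatSum, add_mul]
  exact (summable_bilatSum q a b c).tsum_add (summable_bilatSum q a b d)

theorem bilatSum_const_mul (q : ℂ) (a b : ℤ) (x : ℂ) (c : ℤ → ℂ) :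
    bilatSum q a b (fun r => x * c r) = x * bilatSum q a b c := by
  simp only [bilatSum, mul_assoc]
  exact tsum_mul_left

theorem bilatSum_reflect (q : ℂ) (a b : ℤ) (c : ℤ → ℂ) :
    bilatSum q a b c = bilatSum q a b fun r => c (a - b - r) := by
  rw [bilatSum, ← (Equiv.subLeft (a - b)).tsum_eq, bilatSum]
  refine tsum_congr fun r => ?_
  simp only [Equiv.subLeft_apply]
  rw [show a - (a - b - r) = b + r by ring, show b + (a - b - r) = a - r by ring,
    mul_comm (qFactInv q (b + r))]

/-- With X = q^(2(a-r)) and Y = q^(2(b+r)), write 1 - XY = (1 - Y) + Y (1 - X). Each bracket lowers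
the index of one reciprocal factorial, and shifting r by one in the second part restores the common
shape. The left version uses (1 - X) + X (1 - Y). -/
theorem bilatSum_step_right {q : ℂ} (hq0 : q ≠ 0) (hq : ‖q‖ < 1) (a b : ℤ) (c : ℤ → ℂ) :
    (1 - q ^ (2 * (a + b))) * bilatSum q a b c =
      bilatSum q a (b - 1) fun r => c r + q ^ (2 * (b + r - 1)) * c (r - 1) := by
  rw [bilatSum_add, bilatSum, ← tsum_mul_left]
  have h : bilatSum q a (b - 1) (fun r => q ^ (2 * (b + r - 1)) * c (r - 1)) =
      ∑' r : ℤ, q ^ (2 * (b + r)) * c r * (qFactInv q (a - r - 1) * qFactInv q (b + r)) := by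
    rw [bilatSum, ← (Equiv.addRight (1 : ℤ)).tsum_eq]
    refine tsum_congr fun r => ?_
    simp only [Equiv.coe_addRight]
    rw [show b + (r + 1) - 1 = b + r by ring, show r + 1 - 1 = r by ring,
      show a - (r + 1) = a - r - 1 by ring, show b - 1 + (r + 1) = b + r by ring]
  rw [h, bilatSum, ← (summable_bilatSum q a (b - 1) c).tsum_add]
  · refine tsum_congr fun r => ?_
    rw [show b - 1 + r = b + r - 1 by ring, qFactInv_sub_one hq, qFactInv_sub_one hq,
      show 2 * (a + b) = 2 * (a - r) + 2 * (b + r) by ring, zpow_add₀ hq0]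
    ring
  · refine (summable_bilatSum q (a - 1) b fun r => q ^ (2 * (b + r)) * c r).congr fun r => ?_
    rw [show a - r - 1 = a - 1 - r by ring]

theorem bilatSum_step_left {q : ℂ} (hq0 : q ≠ 0) (hq : ‖q‖ < 1) (a b : ℤ) (c : ℤ → ℂ) :
    (1 - q ^ (2 * (a + b))) * bilatSum q a b c =
      bilatSum q (a - 1) b fun r => c r + q ^ (2 * (a - r - 1)) * c (r + 1) := by
  rw [bilatSum_add, bilatSum, ← tsum_mul_left]
  have h : bilatSum q (a - 1) b (fun r => q ^ (2 * (a - r - 1)) * c (r + 1)) =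
      ∑' r : ℤ, q ^ (2 * (a - r)) * c r * (qFactInv q (a - r) * qFactInv q (b + r - 1)) := by
    rw [bilatSum, ← (Equiv.subRight (1 : ℤ)).tsum_eq]
    refine tsum_congr fun r => ?_
    simp only [Equiv.subRight_apply]
    rw [show a - (r - 1) - 1 = a - r by ring, show r - 1 + 1 = r by ring,
      show a - 1 - (r - 1) = a - r by ring, show b + (r - 1) = b + r - 1 by ring]
  rw [h, bilatSum, ← (summable_bilatSum q (a - 1) b c).tsum_add]
  · refine tsum_congr fun r => ?_
    rw [show a - 1 - r = a - r - 1 by ring, qFactInv_sub_one hq, qFactInv_sub_one hq,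
      show 2 * (a + b) = 2 * (a - r) + 2 * (b + r) by ring, zpow_add₀ hq0]
    ring
  · refine (summable_bilatSum q a (b - 1) fun r => q ^ (2 * (a - r)) * c r).congr fun r => ?_
    rw [show b + r - 1 = b - 1 + r by ring]

theorem one_sub_zpow_natCast_ne_zero {q : ℂ} (hq : ‖q‖ < 1) {k : ℤ} (n : ℕ) (hk : k = n + 1) :
    1 - q ^ k ≠ 0 := by
  have : k = (n + 1 : ℕ) := by rw [hk]; push_cast; ring
  rw [this, zpow_natCast]
  exact one_sub_ne_zero_of_norm (norm_pow_lt_one hq n.succ_ne_zero)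

/-- The odd-length finite triple product follows from the even-length one. -/
theorem bilatSum_triple_odd_of_even {q : ℂ} (hq0 : q ≠ 0) (hq : ‖q‖ < 1) (n : ℕ)
    (h : ∀ z : ℂ, z ≠ 0 → bilatSum q n n (fun r => z ^ r * q ^ (r ^ 2)) =
      qPoch (-z * q) (q ^ 2) n * qPoch (-q / z) (q ^ 2) n * qFactInv q (2 * n : ℕ))
    {z : ℂ} (hz : z ≠ 0) :
    bilatSum q n (n + 1) (fun r => z ^ r * q ^ (r ^ 2 + r)) =
      qPoch (-z * q ^ 2) (q ^ 2) n * qPoch (-1 / z) (q ^ 2) (n + 1) *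
        qFactInv q (2 * n + 1 : ℕ) := by
  have h1 := bilatSum_step_right hq0 hq n (n + 1) fun r => z ^ r * q ^ (r ^ 2 + r)
  -- Both contributions are proportional, so the step yields one new linear factor times the even
  -- sum at z q.
  have h2 : (fun r : ℤ => z ^ r * q ^ (r ^ 2 + r) + q ^ (2 * ((n : ℤ) + 1 + r - 1)) *
      (z ^ (r - 1) * q ^ ((r - 1) ^ 2 + (r - 1)))) =
      fun r : ℤ => (1 - -1 / z * (q ^ 2) ^ n) * ((z * q) ^ r * q ^ (r ^ 2)) := by
    funext r
    have e : q ^ (2 * ((n : ℤ) + 1 + r - 1)) * q ^ ((r - 1) ^ 2 + (r - 1)) =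
        (q ^ 2) ^ n * q ^ r * q ^ (r ^ 2) := by
      rw [← pow_mul, ← zpow_natCast, ← zpow_add₀ hq0, ← zpow_add₀ hq0, ← zpow_add₀ hq0]
      congr 1; push_cast; ring
    calc _ = z ^ r * q ^ (r ^ 2 + r) + z ^ (r - 1) * (q ^ (2 * ((n : ℤ) + 1 + r - 1)) *
          q ^ ((r - 1) ^ 2 + (r - 1))) := by ring
      _ = _ := by
        rw [e, zpow_sub_one₀ hz, mul_zpow, zpow_add₀ hq0]
        ring
  have h3 := one_sub_zpow_natCast_ne_zero hq (k := 2 * ((n : ℤ) + (n + 1))) (4 * n + 1)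
    (by push_cast; ring)
  have h4 := qFactInv_sub_one hq ((2 * n + 1 : ℕ) : ℤ)
  rw [show ((2 * n + 1 : ℕ) : ℤ) - 1 = (2 * n : ℕ) by push_cast; ring,
    show 2 * ((2 * n + 1 : ℕ) : ℤ) = 2 * ((n : ℤ) + (n + 1)) by push_cast; ring] at h4
  rw [h2, bilatSum_const_mul, add_sub_cancel_right, h _ (mul_ne_zero hz hq0), h4] at h1
  refine mul_left_cancel₀ h3 (h1.trans ?_)
  rw [qPoch_succ, show -q / (z * q) = -1 / z by field_simp,
    show -(z * q) * q = -z * q ^ 2 by ring]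
  ring

/-- The finite form of the Jacobi triple product. -/
theorem bilatSum_triple {q : ℂ} (hq0 : q ≠ 0) (hq : ‖q‖ < 1) (n : ℕ) :
    ∀ z : ℂ, z ≠ 0 → bilatSum q n n (fun r => z ^ r * q ^ (r ^ 2)) =
      qPoch (-z * q) (q ^ 2) n * qPoch (-q / z) (q ^ 2) n * qFactInv q (2 * n : ℕ) := by
  induction n with
  | zero =>
    intro z hz
    rw [bilatSum, tsum_eq_single 0]
    · simp [qPoch_zero, qFactInv]
    · intro r hr
      rcases lt_or_gt_of_ne hr with h | h
      · rw [qFactInv_of_neg q (by push_cast; omega : ((0 : ℕ) : ℤ) + r < 0), mul_zero, mul_zero]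
      · rw [qFactInv_of_neg q (by push_cast; omega : ((0 : ℕ) : ℤ) - r < 0), zero_mul, mul_zero]
  | succ n ih =>
    intro z hz
    -- Lowering the left index replaces z by z / q, so the odd case is needed at that argument.
    have h0 := bilatSum_triple_odd_of_even hq0 hq n ih (div_ne_zero hz hq0)
    have h1 := bilatSum_step_left hq0 hq (n + 1) (n + 1) fun r => z ^ r * q ^ (r ^ 2)
    have h2 : (fun r : ℤ => z ^ r * q ^ (r ^ 2) + q ^ (2 * ((n : ℤ) + 1 - r - 1)) *
        (z ^ (r + 1) * q ^ ((r + 1) ^ 2))) =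
        fun r : ℤ => (1 - -z * q * (q ^ 2) ^ n) * ((z / q) ^ r * q ^ (r ^ 2 + r)) := by
      funext r
      have e : q ^ (2 * ((n : ℤ) + 1 - r - 1)) * q ^ ((r + 1) ^ 2) =
          (q ^ 2) ^ n * q * q ^ (r ^ 2) := by
        rw [← pow_mul, ← zpow_natCast, ← zpow_add₀ hq0, ← zpow_add_one₀ hq0, ← zpow_add₀ hq0]
        congr 1; push_cast; ring
      have e2 : q ^ r * (q ^ r)⁻¹ = 1 := mul_inv_cancel₀ (zpow_ne_zero r hq0)
      calc _ = z ^ r * q ^ (r ^ 2) + z ^ (r + 1) * (q ^ (2 * ((n : ℤ) + 1 - r - 1)) *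
            q ^ ((r + 1) ^ 2)) := by ring
        _ = (1 - -z * q * (q ^ 2) ^ n) * z ^ r * q ^ (r ^ 2) * (q ^ r * (q ^ r)⁻¹) := by
          rw [e, e2, zpow_add_one₀ hz]
          ring
        _ = _ := by
          rw [div_zpow, zpow_add₀ hq0]
          ring
    have h3 := one_sub_zpow_natCast_ne_zero hq (k := 2 * ((n : ℤ) + 1 + (n + 1))) (4 * n + 3)
      (by push_cast; ring)
    have h4 := qFactInv_sub_one hq ((2 * (n + 1) : ℕ) : ℤ)
    rw [show ((2 * (n + 1) : ℕ) : ℤ) - 1 = (2 * n + 1 : ℕ) by push_cast; ring,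
      show 2 * ((2 * (n + 1) : ℕ) : ℤ) = 2 * ((n : ℤ) + 1 + (n + 1)) by push_cast; ring] at h4
    rw [h2, bilatSum_const_mul, add_sub_cancel_right, h0, h4] at h1
    push_cast at h1 ⊢
    refine mul_left_cancel₀ h3 (h1.trans ?_)
    rw [qPoch_succ (-z * q), show -1 / (z / q) = -q / z by field_simp,
      show -(z / q) * q ^ 2 = -z * q by field_simp]
    ring

theorem bilatSum_triple_odd {q : ℂ} (hq0 : q ≠ 0) (hq : ‖q‖ < 1) (n : ℕ) {z : ℂ} (hz : z ≠ 0) :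
    bilatSum q n (n + 1) (fun r => z ^ r * q ^ (r ^ 2 + r)) =
      qPoch (-z * q ^ 2) (q ^ 2) n * qPoch (-1 / z) (q ^ 2) (n + 1) *
        qFactInv q (2 * n + 1 : ℕ) :=
  bilatSum_triple_odd_of_even hq0 hq n (bilatSum_triple hq0 hq n) hz

/-- The step produces the original coefficients plus q^(2n+1) times their reflection under r ↦ -r.
Both sums have the same value, and (1 + q^(2n+1)) / (1 - q^(4n+2)) is the new factor 1 / (1 -
q^(2n+1)). -/
theorem bilatSum_triangular_odd_of_even {q : ℂ} (hq0 : q ≠ 0) (hq : ‖q‖ < 1) (n : ℕ)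
    (h : bilatSum q n n (fun r => q ^ (2 * r ^ 2 + r)) = (qPoch q q (2 * n))⁻¹) :
    bilatSum q n (n + 1) (fun r => q ^ (2 * r ^ 2 + r)) = (qPoch q q (2 * n + 1))⁻¹ := by
  have h1 := bilatSum_step_right hq0 hq n (n + 1) fun r => q ^ (2 * r ^ 2 + r)
  have h2 : (fun r : ℤ => q ^ (2 * r ^ 2 + r) + q ^ (2 * ((n : ℤ) + 1 + r - 1)) *
      q ^ (2 * (r - 1) ^ 2 + (r - 1))) =
      fun r : ℤ => q ^ (2 * r ^ 2 + r) + q ^ (2 * (n : ℤ) + 1) * q ^ (2 * r ^ 2 - r) := by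
    funext r
    rw [← zpow_add₀ hq0, ← zpow_add₀ hq0]
    congr 2; ring
  have h5 : bilatSum q n n (fun r => q ^ (2 * r ^ 2 - r)) = (qPoch q q (2 * n))⁻¹ := by
    rw [bilatSum_reflect, ← h]
    congr 1; funext r; congr 1; ring
  rw [h2, bilatSum_add, bilatSum_const_mul, add_sub_cancel_right, h5, h] at h1
  have h3 := one_sub_zpow_natCast_ne_zero hq (k := 2 * ((n : ℤ) + (n + 1))) (4 * n + 1)
    (by push_cast; ring)
  have h6 := one_sub_zpow_natCast_ne_zero hq (k := 2 * (n : ℤ) + 1) (2 * n) (by push_cast; ring)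
  have h7 : q * q ^ (2 * n) = q ^ (2 * (n : ℤ) + 1) := by
    rw [zpow_add_one₀ hq0, mul_comm]; norm_cast
  refine mul_left_cancel₀ h3 (h1.trans ?_)
  rw [qPoch_succ, h7, show 2 * ((n : ℤ) + (n + 1)) = (2 * n + 1) + (2 * n + 1) by ring,
    zpow_add₀ hq0 (2 * (n : ℤ) + 1) (2 * (n : ℤ) + 1)]
  have h8 := qPoch_ne_zero_of_norm hq hq (2 * n)
  generalize q ^ (2 * (n : ℤ) + 1) = X at h6 ⊢
  field_simp
  ring

theorem bilatSum_triangular {q : ℂ} (hq0 : q ≠ 0) (hq : ‖q‖ < 1) (n : ℕ) :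
    bilatSum q n n (fun r => q ^ (2 * r ^ 2 + r)) = (qPoch q q (2 * n))⁻¹ := by
  induction n with
  | zero =>
    rw [bilatSum, tsum_eq_single 0]
    · simp [qPoch_zero, qFactInv]
    · intro r hr
      rcases lt_or_gt_of_ne hr with h | h
      · rw [qFactInv_of_neg q (by push_cast; omega : ((0 : ℕ) : ℤ) + r < 0), mul_zero, mul_zero]
      · rw [qFactInv_of_neg q (by push_cast; omega : ((0 : ℕ) : ℤ) - r < 0), zero_mul, mul_zero]
  | succ n ih =>
    have h := bilatSum_triangular_odd_of_even hq0 hq n ih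
    have h1 := bilatSum_step_left hq0 hq (n + 1) (n + 1) fun r => q ^ (2 * r ^ 2 + r)
    have h2 : (fun r : ℤ => q ^ (2 * r ^ 2 + r) + q ^ (2 * ((n : ℤ) + 1 - r - 1)) *
        q ^ (2 * (r + 1) ^ 2 + (r + 1))) =
        fun r : ℤ => q ^ (2 * r ^ 2 + r) + q ^ (2 * (n : ℤ) + 2) * q ^ (2 * r ^ 2 + 3 * r + 1) := by
      funext r
      rw [← zpow_add₀ hq0, ← zpow_add₀ hq0]
      congr 2; ring
    -- The reflection is now r ↦ -1 - r, which carries 2r^2 + 3r + 1 to 2r^2 + r.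
    have h5 : bilatSum q n (n + 1) (fun r => q ^ (2 * r ^ 2 + 3 * r + 1)) =
        (qPoch q q (2 * n + 1))⁻¹ := by
      rw [bilatSum_reflect, ← h]
      congr 1; funext r; congr 1; ring
    rw [h2, bilatSum_add, bilatSum_const_mul, add_sub_cancel_right, h5, h] at h1
    have h3 := one_sub_zpow_natCast_ne_zero hq (k := 2 * ((n : ℤ) + 1 + (n + 1))) (4 * n + 3)
      (by push_cast; ring)
    have h6 := one_sub_zpow_natCast_ne_zero hq (k := 2 * (n : ℤ) + 2) (2 * n + 1)
      (by push_cast; ring)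
    have h7 : q * q ^ (2 * n + 1) = q ^ (2 * (n : ℤ) + 2) := by
      rw [← pow_succ', ← zpow_natCast]; congr 1
    push_cast
    refine mul_left_cancel₀ h3 (h1.trans ?_)
    rw [mul_add 2 n 1, mul_one, qPoch_succ _ _ (2 * n + 1), h7,
      show 2 * ((n : ℤ) + 1 + (n + 1)) = (2 * n + 2) + (2 * n + 2) by ring,
      zpow_add₀ hq0 (2 * (n : ℤ) + 2) (2 * (n : ℤ) + 2)]
    have h8 := qPoch_ne_zero_of_norm hq hq (2 * n + 1)
    generalize q ^ (2 * (n : ℤ) + 2) = X at h6 ⊢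
    field_simp
    ring

theorem bilatSum_triangular_odd {q : ℂ} (hq0 : q ≠ 0) (hq : ‖q‖ < 1) (n : ℕ) :
    bilatSum q n (n + 1) (fun r => q ^ (2 * r ^ 2 + r)) = (qPoch q q (2 * n + 1))⁻¹ :=
  bilatSum_triangular_odd_of_even hq0 hq n (bilatSum_triangular hq0 hq n)

/-- The Jacobi triple product. -/
theorem tsum_zpow_mul_zpow_sq {q : ℂ} (hq0 : q ≠ 0) (hq : ‖q‖ < 1) {z : ℂ} (hz : z ≠ 0) :
    ∑' r : ℤ, z ^ r * q ^ (r ^ 2) =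
      qPochInf (-z * q) (q ^ 2) * qPochInf (-q / z) (q ^ 2) * qPochInf (q ^ 2) (q ^ 2) := by
  have h2 := norm_pow_lt_one hq two_ne_zero
  have hne := qPochInf_ne_zero_of_norm h2 h2
  obtain ⟨C, hC0, hC⟩ := exists_norm_qFactInv_le hq
  -- In the finite triple product each reciprocal factorial tends to 1 / (p; p)_∞ for fixed r, and
  -- the Gaussian decay of the coefficients justifies the termwise limit.
  have hL : Tendsto (fun n : ℕ => bilatSum q n n fun r => z ^ r * q ^ (r ^ 2)) atTop
      (𝓝 (∑' r : ℤ, z ^ r * q ^ (r ^ 2) *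
        ((qPochInf (q ^ 2) (q ^ 2))⁻¹ * (qPochInf (q ^ 2) (q ^ 2))⁻¹))) := by
    refine tendsto_tsum_of_dominated_convergence
      ((summable_norm_zpow_mul_zpow_sq hq z).mul_right (C * C)) (fun r => ?_)
      (Eventually.of_forall fun n r => ?_)
    · have ht (s : ℤ) : Tendsto (fun n : ℕ => qFactInv q (n + s)) atTop
          (𝓝 (qPochInf (q ^ 2) (q ^ 2))⁻¹) := by
        have hs : Tendsto (fun n : ℕ => ((n : ℤ) + s).toNat) atTop atTop :=
          tendsto_atTop.mpr fun b => eventually_atTop.mpr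
            ⟨(b - s).toNat, fun n hn => by omega⟩
        refine ((tendsto_qFactInv hq).comp hs).congr' ?_
        refine eventually_atTop.mpr ⟨(-s).toNat, fun n hn => ?_⟩
        simp only [Function.comp]
        rw [Int.toNat_of_nonneg (by omega)]
      simpa only [sub_eq_add_neg] using ((ht (-r)).mul (ht r)).const_mul _
    · rw [norm_mul, norm_mul (qFactInv _ _)]
      gcongr
      · exact hC _
      · exact hC _
  have hR := ((tendsto_qPoch h2 (-z * q)).mul (tendsto_qPoch h2 (-q / z))).mul
    ((tendsto_qFactInv hq).comp (tendsto_id.const_mul_atTop' two_pos))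
  have h := tendsto_nhds_unique hL (hR.congr fun n => (bilatSum_triple hq0 hq n z hz).symm)
  rw [tsum_mul_right] at h
  field_simp at h
  rw [h]
  ring_nf

/-- Interchange of summation in a series of bilateral sums. -/
theorem tsum_mul_bilatSum {q : ℂ} (hq : ‖q‖ < 1) (δ : ℤ) {g : ℕ → ℂ} (hg : Summable (‖g ·‖))
    {c : ℤ → ℂ} (hc : Summable (‖c ·‖)) :
    ∑' n : ℕ, g n * bilatSum q n (n + δ) c =
      ∑' r : ℤ, c r * ∑' n : ℕ, g n * (qFactInv q (n - r) * qFactInv q (n + δ + r)) := by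
  obtain ⟨C, hC0, hC⟩ := exists_norm_qFactInv_le hq
  have hs : Summable (Function.uncurry fun (n : ℕ) (r : ℤ) =>
      g n * (c r * (qFactInv q (n - r) * qFactInv q (n + δ + r)))) := by
    refine Summable.of_norm_bounded ((hg.mul_of_nonneg hc (fun _ => norm_nonneg _)
      fun _ => norm_nonneg _).mul_right (C * C)) fun ⟨n, r⟩ => ?_
    simp only [Function.uncurry_apply_pair, norm_mul]
    rw [mul_assoc]
    gcongr
    · exact hC _
    · exact hC _
  simp only [bilatSum, ← tsum_mul_left]
  rw [← hs.tsum_comm]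
  refine tsum_congr fun r => tsum_congr fun n => ?_
  ring

/-! ### A limiting case of Bailey's lemma -/

/-- The weight `(-q ^ (1 + δ) / w; p)_n wⁿ q ^ (n² + δ n)`, for `p = q ^ 2`. -/
def baileyWeight (q w : ℂ) (δ n : ℕ) : ℂ :=
  qPoch (-q ^ (1 + δ) / w) (q ^ 2) n * w ^ n * q ^ (n ^ 2 + δ * n)

theorem summable_norm_baileyWeight {q : ℂ} (hq : ‖q‖ < 1) (w : ℂ) (δ : ℕ) :
    Summable (‖baileyWeight q w δ ·‖) := by
  have h2 := norm_pow_lt_one hq two_ne_zero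
  refine Summable.of_nonneg_of_le (fun _ => norm_nonneg _) (fun n => ?_)
    ((summable_norm_pow_mul_pow_sq hq (w * q ^ δ)).mul_left
      (Real.exp (‖-q ^ (1 + δ) / w‖ / (1 - ‖q ^ 2‖))))
  have e : baileyWeight q w δ n = qPoch (-q ^ (1 + δ) / w) (q ^ 2) n *
      ((w * q ^ δ) ^ n * q ^ (n ^ 2)) := by
    rw [baileyWeight, mul_pow, pow_add q (n ^ 2), pow_mul q δ]
    ring
  rw [e, norm_mul]
  exact mul_le_mul_of_nonneg_right (norm_qPoch_le h2 _ n) (norm_nonneg _)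

/-- The series of weights against a product of two reciprocal factorials. -/
def baileySum (q w : ℂ) (δ : ℕ) (r : ℤ) : ℂ :=
  ∑' n : ℕ, baileyWeight q w δ n * (qFactInv q (n - r) * qFactInv q (n + δ + r))

theorem baileySum_reflect (q w : ℂ) (δ : ℕ) (r : ℤ) :
    baileySum q w δ (-r - δ) = baileySum q w δ r := by
  refine tsum_congr fun n => ?_
  rw [show (n : ℤ) - (-r - δ) = n + δ + r by ring, show (n : ℤ) + δ + (-r - δ) = n - r by ring,
    mul_comm (qFactInv q (n - r))]

/-- Only n ≥ r contributes. After n = m + r the second reciprocal factorial is an infinite product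
divided by (p; p)_∞, and the weight is chosen so that its parameter satisfies c = -a y q, the
condition under which the `₁φ₁` series sums. -/
theorem baileySum_natCast {q : ℂ} (hq : ‖q‖ < 1) {w : ℂ} (hw : w ≠ 0) (δ r : ℕ) :
    baileySum q w δ r = baileyWeight q w δ r * qPochInf (-w * q ^ (2 * r + δ + 1)) (q ^ 2) /
      qPochInf (q ^ 2) (q ^ 2) := by
  have hsupp : Function.support (fun n : ℕ => baileyWeight q w δ n *
      (qFactInv q ((n : ℤ) - (r : ℕ)) * qFactInv q ((n : ℤ) + δ + (r : ℕ)))) ⊆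
      Set.range fun m : ℕ => m + r := by
    intro n hn
    by_contra h
    have hlt : n < r := by
      by_contra hge
      exact h ⟨n - r, Nat.sub_add_cancel (not_lt.mp hge)⟩
    exact hn (by simp only; rw [qFactInv_of_neg q (by omega), zero_mul, mul_zero])
  rw [baileySum, ← (add_left_injective r).tsum_eq hsupp]
  have h := tsum_phiTerm hq (-q ^ (1 + δ) / w * (q ^ 2) ^ r) (w * q ^ (2 * r + δ))
  rw [show -w * q ^ (2 * r + δ + 1) = -(w * q ^ (2 * r + δ)) * q by ring, ← h, mul_div_right_comm,
    ← tsum_mul_left]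
  refine tsum_congr fun m => ?_
  have e1 : ((m + r : ℕ) : ℤ) - (r : ℕ) = (m : ℕ) := by push_cast; ring
  have e2 : ((m + r : ℕ) : ℤ) + δ + (r : ℕ) = (m + 2 * r + δ : ℕ) := by push_cast; ring
  have e3 : -(-q ^ (1 + δ) / w * (q ^ 2) ^ r) * (w * q ^ (2 * r + δ)) * q * (q ^ 2) ^ m =
      q ^ 2 * (q ^ 2) ^ (m + 2 * r + δ) := by
    field_simp
    ring
  rw [e1, e2, qFactInv_natCast_eq hq (m + 2 * r + δ), phiTerm, e3, baileyWeight, baileyWeight,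
    add_comm m r, qPoch_add]
  ring

/-- A limiting case of Bailey's lemma, for bilateral sums and a symmetric weight. -/
theorem tsum_baileyWeight_mul_bilatSum {q : ℂ} (hq : ‖q‖ < 1) (w : ℂ) {δ : ℕ} (hδ : δ ≤ 1)
    {c τ : ℤ → ℂ} (hc : Summable (‖c ·‖)) {K : ℂ} (hτ : ∀ r, τ (-r - δ) = τ r)
    (hK : ∀ r : ℕ, baileySum q w δ r = K * τ r) :
    ∑' n : ℕ, baileyWeight q w δ n * bilatSum q n (n + δ) c = K * ∑' r, c r * τ r := by
  rw [tsum_mul_bilatSum hq δ (summable_norm_baileyWeight hq w δ) hc, ← tsum_mul_left]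
  refine tsum_congr fun r => ?_
  change c r * baileySum q w δ r = _
  -- A negative r is carried by r ↦ -r - δ to a natural number; this uses δ ≤ 1.
  have h : baileySum q w δ r = K * τ r := by
    rcases le_or_gt 0 r with hr | hr
    · obtain ⟨n, rfl⟩ := Int.eq_ofNat_of_zero_le hr
      exact hK n
    · obtain ⟨n, hn⟩ := Int.eq_ofNat_of_zero_le (by omega : 0 ≤ -r - δ)
      rw [← baileySum_reflect, ← hτ, hn]
      exact hK n
  rw [h]
  ring

/-- The same with the coefficients symmetrized. -/
theorem tsum_baileyWeight_mul_bilatSum_symm {q : ℂ} (hq : ‖q‖ < 1) (w : ℂ) {δ : ℕ} (hδ : δ ≤ 1)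
    {c τ : ℤ → ℂ} (hc : Summable (‖c ·‖)) {K : ℂ} (hτ : ∀ r, τ (-r - δ) = τ r)
    (hK : ∀ r : ℕ, baileySum q w δ r = K * τ r) :
    ∑' n : ℕ, baileyWeight q w δ n * bilatSum q n (n + δ) c =
      K / 2 * ∑' r, (c r + c (-r - δ)) * τ r := by
  have hc' : Summable fun r : ℤ => ‖c (-r - δ)‖ := by
    refine ((Equiv.subLeft (-(δ : ℤ))).summable_iff.mpr hc).congr fun r => ?_
    simp only [Function.comp, Equiv.subLeft_apply]
    rw [show -(δ : ℤ) - r = -r - δ by ring]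
  have hs : Summable fun r : ℤ => ‖c r + c (-r - δ)‖ :=
    Summable.of_nonneg_of_le (fun _ => norm_nonneg _) (fun r => norm_add_le _ _) (hc.add hc')
  have h := tsum_baileyWeight_mul_bilatSum hq w hδ hs hτ hK
  -- The reflection r ↦ -r - δ preserves the bilateral sum, so symmetrizing its coefficients only
  -- doubles it.
  have h2 (n : ℕ) : bilatSum q n (n + δ) (fun r => c r + c (-r - δ)) =
      2 * bilatSum q n (n + δ) c := by
    rw [bilatSum_add, two_mul, bilatSum_reflect q n (n + δ) c]
    congr 2
    funext r
    rw [show (n : ℤ) - (n + δ) - r = -r - δ by ring]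
  simp only [h2, mul_left_comm _ (2 : ℂ)] at h
  rw [tsum_mul_left] at h
  linear_combination h / 2

/-! ### Reduction of the quadruple series to two single series -/

theorem nahmTerm_eq_qFactInv (u v w t q : ℂ) (i j k l : ℕ) :
    nahmTerm u v w t q (i, j, k, l) = u ^ i * v ^ j * w ^ k * t ^ l *
      q ^ ((i : ℤ) ^ 2 + (j : ℤ) ^ 2 + (k : ℤ) ^ 2 + (l : ℤ) ^ 2
              - (i : ℤ) * l - (j : ℤ) * l - (k : ℤ) * l) *
      (qFactInv q i * qFactInv q j * qFactInv q k * qFactInv q l) := by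
  simp only [nahmTerm, qFactInv_natCast, div_eq_mul_inv, mul_inv]

theorem summable_nahmTerm {q : ℂ} (hq0 : q ≠ 0) (hq : ‖q‖ < 1) (u v w t : ℂ) :
    Summable (nahmTerm u v w t q) := by
  obtain ⟨C, hC0, hC⟩ := exists_norm_qFactInv_le hq
  have hr : 0 < ‖q‖ := norm_pos_iff.mpr hq0
  -- The quadratic form is at least (i^2 + j^2 + k^2 + l^2) / 8. Indeed eight times the form minus
  -- the sum of squares equals the sum of the three (7x - 4l)^2 / 7, for x = i, j, k, plus l^2 / 7.
  -- With s^8 = |q| the series is dominated by a product of four Gaussian series.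
  obtain ⟨s, hs0, hs1, hs⟩ : ∃ s : ℝ, 0 < s ∧ s < 1 ∧ s ^ 8 = ‖q‖ := by
    refine ⟨‖q‖ ^ ((8 : ℕ) : ℝ)⁻¹, by positivity, ?_, Real.rpow_inv_natCast_pow hr.le (by norm_num)⟩
    exact Real.rpow_lt_one hr.le hq (by positivity)
  have hsum (x : ℂ) : Summable fun n : ℕ => ‖x‖ ^ n * s ^ (n ^ 2) := by
    simpa using summable_pow_mul_pow_sq ‖x‖ hs0.le hs1
  have h0 (x : ℂ) : 0 ≤ fun n : ℕ => ‖x‖ ^ n * s ^ (n ^ 2) := fun n => by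
    simp only [Pi.zero_apply]; positivity
  have hbig := (hsum u).mul_of_nonneg ((hsum v).mul_of_nonneg ((hsum w).mul_of_nonneg (hsum t)
    (h0 w) (h0 t)) (h0 v) (fun x => mul_nonneg (h0 w _) (h0 t _))) (h0 u)
    (fun x => mul_nonneg (h0 v _) (mul_nonneg (h0 w _) (h0 t _)))
  refine Summable.of_norm_bounded (hbig.mul_right (C * C * C * C)) fun ⟨i, j, k, l⟩ => ?_
  have hQ : ‖q‖ ^ ((i : ℤ) ^ 2 + (j : ℤ) ^ 2 + (k : ℤ) ^ 2 + (l : ℤ) ^ 2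
      - (i : ℤ) * l - (j : ℤ) * l - (k : ℤ) * l) ≤ s ^ (i ^ 2 + j ^ 2 + k ^ 2 + l ^ 2) := by
    rw [← hs, ← zpow_natCast s 8, ← zpow_mul, ← zpow_natCast s (_ + _)]
    refine zpow_le_zpow_right_of_le_one₀ hs0 hs1.le ?_
    push_cast
    nlinarith [sq_nonneg (7 * (i : ℤ) - 4 * l), sq_nonneg (7 * (j : ℤ) - 4 * l),
      sq_nonneg (7 * (k : ℤ) - 4 * l), sq_nonneg (l : ℤ)]
  rw [nahmTerm_eq_qFactInv]
  simp only [norm_mul, norm_pow, norm_zpow]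
  calc _ ≤ ‖u‖ ^ i * ‖v‖ ^ j * ‖w‖ ^ k * ‖t‖ ^ l * s ^ (i ^ 2 + j ^ 2 + k ^ 2 + l ^ 2) *
        (C * C * C * C) := by
        gcongr <;> exact hC _
    _ = _ := by ring

/-- The case a = c = 0 of the `₁φ₁` summation. -/
theorem tsum_euler {q : ℂ} (hq : ‖q‖ < 1) (y : ℂ) :
    ∑' n : ℕ, y ^ n * q ^ (n ^ 2) * qFactInv q n = qPochInf (-y * q) (q ^ 2) := by
  have h := tsum_phiTerm hq 0 y
  simpa [phiTerm, qPoch, qPochInf_zero] using h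

theorem summable_norm_euler {q : ℂ} (hq : ‖q‖ < 1) (y : ℂ) :
    Summable fun n : ℕ => ‖y ^ n * q ^ (n ^ 2) * qFactInv q n‖ := by
  have h := (summable_phiTerm hq 0 y 0).norm
  simpa [phiTerm, qPoch, qPochInf_zero] using h

theorem nahmTerm_eq_mul {q : ℂ} (hq0 : q ≠ 0) (u v w t : ℂ) (i j k l : ℕ) :
    nahmTerm u v w t q (i, j, k, l) = t ^ l * q ^ (l ^ 2) * qFactInv q l *
      (((u / q ^ l) ^ i * q ^ (i ^ 2) * qFactInv q i) *
        (((v / q ^ l) ^ j * q ^ (j ^ 2) * qFactInv q j) *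
          ((w / q ^ l) ^ k * q ^ (k ^ 2) * qFactInv q k))) := by
  rw [nahmTerm_eq_qFactInv, zpow_sub₀ hq0, zpow_sub₀ hq0, zpow_sub₀ hq0, zpow_add₀ hq0,
    zpow_add₀ hq0, zpow_add₀ hq0]
  simp only [← Nat.cast_pow, ← Nat.cast_mul, zpow_natCast, div_pow, ← pow_mul, mul_comm l]
  ring

theorem nahmF_eq_tsum {q : ℂ} (hq0 : q ≠ 0) (hq : ‖q‖ < 1) (u v w t : ℂ) :
    nahmF u v w t q = ∑' l : ℕ, t ^ l * q ^ (l ^ 2) * qFactInv q l *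
      (qPochInf (-(u / q ^ l) * q) (q ^ 2) * (qPochInf (-(v / q ^ l) * q) (q ^ 2) *
        qPochInf (-(w / q ^ l) * q) (q ^ 2))) ∧
    Summable fun l : ℕ => t ^ l * q ^ (l ^ 2) * qFactInv q l *
      (qPochInf (-(u / q ^ l) * q) (q ^ 2) * (qPochInf (-(v / q ^ l) * q) (q ^ 2) *
        qPochInf (-(w / q ^ l) * q) (q ^ 2))) := by
  -- Moves l to the front, so that the sum over (i, j, k) becomes the inner one and factors.
  let e : ℕ × ℕ × ℕ × ℕ ≃ ℕ × ℕ × ℕ × ℕ :=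
    ⟨fun n => (n.2.1, n.2.2.1, n.2.2.2, n.1), fun n => (n.2.2.2, n.1, n.2.1, n.2.2.1),
      fun _ => rfl, fun _ => rfl⟩
  have hs : Summable fun n => nahmTerm u v w t q (e n) :=
    e.summable_iff.mpr (summable_nahmTerm hq0 hq u v w t)
  have hin (l : ℕ) : ∑' n : ℕ × ℕ × ℕ, nahmTerm u v w t q (e (l, n)) =
      t ^ l * q ^ (l ^ 2) * qFactInv q l *
      (qPochInf (-(u / q ^ l) * q) (q ^ 2) * (qPochInf (-(v / q ^ l) * q) (q ^ 2) *
        qPochInf (-(w / q ^ l) * q) (q ^ 2))) := by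
    have hu := summable_norm_euler hq (u / q ^ l)
    have hv := summable_norm_euler hq (v / q ^ l)
    have hw := summable_norm_euler hq (w / q ^ l)
    rw [← tsum_euler hq, ← tsum_euler hq, ← tsum_euler hq,
      tsum_mul_tsum_of_summable_norm hv hw, tsum_mul_tsum_of_summable_norm hu (hv.mul_norm hw),
      ← tsum_mul_left]
    exact tsum_congr fun n => nahmTerm_eq_mul hq0 u v w t _ _ _ _
  have h := hs.hasSum.prod_fiberwise fun l => (hs.prod_factor l).hasSum
  simp only [hin] at h
  exact ⟨by rw [h.tsum_eq, nahmF, e.tsum_eq], h.summable⟩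

/-- The part of the series `F(u, v, w, t; q ^ 2)` with last index congruent to `δ` modulo `2`. -/
def nahmHalf (u v w t q : ℂ) (δ : ℕ) : ℂ :=
  t ^ δ * q ^ (δ ^ 2) * (qPochInf (-u * q / q ^ δ) (q ^ 2) * (qPochInf (-v * q / q ^ δ) (q ^ 2) *
    qPochInf (-w * q / q ^ δ) (q ^ 2))) *
  ∑' n : ℕ, (u * v * w * t ^ 2) ^ n * q ^ (n ^ 2 + δ * n) *
    (qPoch (-q ^ (1 + δ) / u) (q ^ 2) n * (qPoch (-q ^ (1 + δ) / v) (q ^ 2) n *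
      qPoch (-q ^ (1 + δ) / w) (q ^ 2) n)) * qFactInv q (2 * n + δ : ℕ)

/-- The first n factors have arguments with shifts that go to infinity with n; reversing them costs
exactly the power q^(n^2 + δn), after which the infinite part no longer depends on n. -/
theorem qPochInf_div_pow {q : ℂ} (hq0 : q ≠ 0) (hq : ‖q‖ < 1) {x : ℂ} (hx : x ≠ 0) (n δ : ℕ) :
    qPochInf (-(x / q ^ (2 * n + δ)) * q) (q ^ 2) * q ^ (n ^ 2 + δ * n) =
      x ^ n * qPoch (-q ^ (1 + δ) / x) (q ^ 2) n * qPochInf (-x * q / q ^ δ) (q ^ 2) := by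
  have h2 := norm_pow_lt_one hq two_ne_zero
  have hX : -x * q / q ^ δ ≠ 0 := div_ne_zero (mul_ne_zero (neg_ne_zero.mpr hx) hq0)
    (pow_ne_zero δ hq0)
  have h := qPoch_reverse hq0 hX n
  have e1 : -(x / q ^ (2 * n + δ)) * q = -x * q / q ^ δ / (q ^ 2) ^ n := by
    rw [pow_add, ← pow_mul]; field_simp
  have e2 : -x * q / q ^ δ / (q ^ 2) ^ n * (q ^ 2) ^ n = -x * q / q ^ δ :=
    div_mul_cancel₀ _ (pow_ne_zero _ (pow_ne_zero _ hq0))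
  have e3 : q ^ 2 / (-x * q / q ^ δ) = -q ^ (1 + δ) / x := by
    field_simp
    ring
  have e4 : (-(-x * q / q ^ δ)) ^ n * q ^ (δ * n) = x ^ n * q ^ n := by
    rw [pow_mul, ← mul_pow, ← mul_pow]
    congr 1
    field_simp
  rw [e3] at h
  rw [e1, qPochInf_eq h2 _ n, e2]
  refine mul_right_cancel₀ (pow_ne_zero n hq0) ?_
  rw [pow_add] at h ⊢
  linear_combination q ^ (δ * n) * qPochInf (-x * q / q ^ δ) (q ^ 2) * h +
    qPoch (-q ^ (1 + δ) / x) (q ^ 2) n * qPochInf (-x * q / q ^ δ) (q ^ 2) * e4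

theorem nahmF_eq_add {q : ℂ} (hq0 : q ≠ 0) (hq : ‖q‖ < 1) {u v w : ℂ} (t : ℂ) (hu : u ≠ 0)
    (hv : v ≠ 0) (hw : w ≠ 0) :
    nahmF u v w t q = nahmHalf u v w t q 0 + nahmHalf u v w t q 1 := by
  obtain ⟨h, hs⟩ := nahmF_eq_tsum hq0 hq u v w t
  have key (δ n : ℕ) : t ^ (2 * n + δ) * q ^ ((2 * n + δ) ^ 2) * qFactInv q (2 * n + δ : ℕ) *
      (qPochInf (-(u / q ^ (2 * n + δ)) * q) (q ^ 2) *
        (qPochInf (-(v / q ^ (2 * n + δ)) * q) (q ^ 2) *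
        qPochInf (-(w / q ^ (2 * n + δ)) * q) (q ^ 2))) =
      t ^ δ * q ^ (δ ^ 2) * (qPochInf (-u * q / q ^ δ) (q ^ 2) *
        (qPochInf (-v * q / q ^ δ) (q ^ 2) * qPochInf (-w * q / q ^ δ) (q ^ 2))) *
      ((u * v * w * t ^ 2) ^ n * q ^ (n ^ 2 + δ * n) *
        (qPoch (-q ^ (1 + δ) / u) (q ^ 2) n * (qPoch (-q ^ (1 + δ) / v) (q ^ 2) n *
          qPoch (-q ^ (1 + δ) / w) (q ^ 2) n)) * qFactInv q (2 * n + δ : ℕ)) := by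
    -- Of the four copies of q^(n^2 + δn), three pay for reversing the three products and one
    -- remains in the series.
    have e : q ^ ((2 * n + δ) ^ 2) = q ^ (δ ^ 2) * q ^ (n ^ 2 + δ * n) * q ^ (n ^ 2 + δ * n) *
        q ^ (n ^ 2 + δ * n) * q ^ (n ^ 2 + δ * n) := by ring
    calc _ = t ^ (2 * n + δ) * (q ^ (δ ^ 2) * q ^ (n ^ 2 + δ * n)) * qFactInv q (2 * n + δ : ℕ) *
          ((qPochInf (-(u / q ^ (2 * n + δ)) * q) (q ^ 2) * q ^ (n ^ 2 + δ * n)) *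
          ((qPochInf (-(v / q ^ (2 * n + δ)) * q) (q ^ 2) * q ^ (n ^ 2 + δ * n)) *
          (qPochInf (-(w / q ^ (2 * n + δ)) * q) (q ^ 2) * q ^ (n ^ 2 + δ * n)))) := by
            rw [e]; ring
      _ = _ := by
        rw [qPochInf_div_pow hq0 hq hu, qPochInf_div_pow hq0 hq hv, qPochInf_div_pow hq0 hq hw]
        simp only [mul_pow, ← pow_mul, pow_add t]
        ring
  rw [h, ← tsum_even_add_odd]
  · congr 1
    · rw [nahmHalf, ← tsum_mul_left]
      exact tsum_congr fun n => key 0 n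
    · rw [nahmHalf, ← tsum_mul_left]
      exact tsum_congr fun n => key 1 n
  · exact hs.comp_injective (mul_right_injective₀ two_ne_zero)
  · exact hs.comp_injective ((add_left_injective 1).comp (mul_right_injective₀ two_ne_zero))

/-! ### Closed forms of the weighted series -/

/-- If q^k = -1 then |q|^k = 1, so k = 0, where the value is 2. Negative k must be allowed because
the denominators of the theta weights run over all integers. -/
theorem one_add_zpow_ne_zero {q : ℂ} (hq : ‖q‖ < 1) (k : ℤ) : 1 + q ^ k ≠ 0 := by
  intro h
  have h1 : q ^ k = -1 := by linear_combination h
  have h2 : ‖q‖ ^ k = 1 := by rw [← norm_zpow, h1, norm_neg, norm_one]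
  rw [(zpow_eq_one_iff_right₀ (norm_nonneg q) hq.ne).mp h2, zpow_zero] at h1
  norm_num at h1

theorem qPochInf_neg_shift {q : ℂ} (hq : ‖q‖ < 1) (a r : ℕ) :
    qPoch (-q ^ a) (q ^ 2) r * qPochInf (-q ^ (2 * r + a)) (q ^ 2) = qPochInf (-q ^ a) (q ^ 2) := by
  rw [qPochInf_eq (norm_pow_lt_one hq two_ne_zero) (-q ^ a) r]
  congr 2
  ring

/-- In this and the next five evaluations the finite product in the weight continues into the
infinite product. For w = 1 they fit exactly; for w = q the factor 1 + q^(2r+δ) is missing and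
becomes a denominator; for w = q^(-1) it occurs twice and becomes a numerator. -/
theorem baileySum_one_zero {q : ℂ} (hq : ‖q‖ < 1) (r : ℕ) :
    baileySum q 1 0 r = qPochInf (-q) (q ^ 2) / qPochInf (q ^ 2) (q ^ 2) * q ^ ((r : ℤ) ^ 2) := by
  have h := qPochInf_neg_shift hq 1 r
  rw [pow_one] at h
  rw [baileySum_natCast hq one_ne_zero, baileyWeight, ← h, ← Nat.cast_pow, zpow_natCast]
  simp only [add_zero, pow_one, div_one, one_pow, mul_one, zero_mul, neg_mul, one_mul]
  ring

theorem baileySum_self_zero {q : ℂ} (hq0 : q ≠ 0) (hq : ‖q‖ < 1) (r : ℕ) :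
    baileySum q q 0 r = qPochInf (-1) (q ^ 2) / qPochInf (q ^ 2) (q ^ 2) *
      (q ^ ((r : ℤ) ^ 2 + r) / (1 + q ^ (2 * (r : ℤ)))) := by
  have h2 := norm_pow_lt_one hq two_ne_zero
  have h := qPochInf_neg_shift hq 0 r
  have h1 := one_add_zpow_ne_zero hq (2 * (r : ℤ))
  have e1 : (q : ℂ) ^ ((r : ℤ) ^ 2 + r) = q ^ (r ^ 2 + r) := by
    rw [← zpow_natCast]; push_cast; rfl
  have e2 : (q : ℂ) ^ (2 * (r : ℤ)) = q ^ (2 * r) := by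
    rw [← zpow_natCast]; push_cast; rfl
  rw [pow_zero, add_zero, qPochInf_succ h2 (-q ^ (2 * r))] at h
  rw [e2] at h1
  rw [baileySum_natCast hq hq0, baileyWeight, ← h, e1, e2]
  simp only [add_zero, pow_one, zero_mul, neg_div, div_self hq0, sub_neg_eq_add]
  rw [show -q ^ (2 * r) * q ^ 2 = -q * q ^ (2 * r + 1) by ring]
  field_simp
  ring

theorem baileySum_inv_zero {q : ℂ} (hq0 : q ≠ 0) (hq : ‖q‖ < 1) (r : ℕ) :
    baileySum q q⁻¹ 0 r = qPochInf (-q ^ 2) (q ^ 2) / qPochInf (q ^ 2) (q ^ 2) *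
      ((1 + q ^ (2 * (r : ℤ))) * q ^ ((r : ℤ) ^ 2 - r)) := by
  have h2 := norm_pow_lt_one hq two_ne_zero
  have h := qPochInf_neg_shift hq 2 r
  have e1 : (q : ℂ) ^ ((r : ℤ) ^ 2 - r) = q ^ (r ^ 2) * q⁻¹ ^ r := by
    rw [zpow_sub₀ hq0, ← Nat.cast_pow, zpow_natCast, zpow_natCast, inv_pow, div_eq_mul_inv]
  have e2 : (q : ℂ) ^ (2 * (r : ℤ)) = q ^ (2 * r) := by
    rw [← zpow_natCast]; push_cast; rfl
  have e3 : -q⁻¹ * q ^ (2 * r + 0 + 1) = -q ^ (2 * r) := by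
    rw [add_zero, pow_succ]; field_simp
  have e4 : -q ^ (1 + 0) / q⁻¹ = -q ^ 2 := by
    rw [add_zero, pow_one]; field_simp
  rw [baileySum_natCast hq (inv_ne_zero hq0), baileyWeight, ← h, e1, e2, e3, e4,
    qPochInf_succ h2 (-q ^ (2 * r)), show -q ^ (2 * r) * q ^ 2 = -q ^ (2 * r + 2) by ring]
  simp only [zero_mul, add_zero, sub_neg_eq_add]
  ring

theorem baileySum_one_one {q : ℂ} (hq : ‖q‖ < 1) (r : ℕ) :
    baileySum q 1 1 r = qPochInf (-q ^ 2) (q ^ 2) / qPochInf (q ^ 2) (q ^ 2) *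
      q ^ ((r : ℤ) ^ 2 + r) := by
  have h := qPochInf_neg_shift hq 2 r
  have e1 : (q : ℂ) ^ ((r : ℤ) ^ 2 + r) = q ^ (r ^ 2 + r) := by
    rw [← zpow_natCast]; push_cast; rfl
  rw [baileySum_natCast hq one_ne_zero, baileyWeight, ← h, e1]
  simp only [div_one, one_pow, mul_one, one_mul, neg_mul, Nat.reduceAdd, add_assoc]
  ring

theorem baileySum_self_one {q : ℂ} (hq0 : q ≠ 0) (hq : ‖q‖ < 1) (r : ℕ) :
    baileySum q q 1 r = qPochInf (-q) (q ^ 2) / qPochInf (q ^ 2) (q ^ 2) *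
      (q ^ ((r : ℤ) ^ 2 + 2 * r) / (1 + q ^ (2 * (r : ℤ) + 1))) := by
  have h2 := norm_pow_lt_one hq two_ne_zero
  have h := qPochInf_neg_shift hq 1 r
  have h1 := one_add_zpow_ne_zero hq (2 * (r : ℤ) + 1)
  have e1 : (q : ℂ) ^ ((r : ℤ) ^ 2 + 2 * r) = q ^ (r ^ 2 + 2 * r) := by
    rw [← zpow_natCast]; push_cast; rfl
  have e2 : (q : ℂ) ^ (2 * (r : ℤ) + 1) = q ^ (2 * r + 1) := by
    rw [← zpow_natCast]; push_cast; rfl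
  have e3 : -q ^ (1 + 1) / q = -q := by field_simp
  rw [pow_one, qPochInf_succ h2 (-q ^ (2 * r + 1))] at h
  rw [e2] at h1
  rw [baileySum_natCast hq hq0, baileyWeight, ← h, e1, e2, e3,
    show -q ^ (2 * r + 1) * q ^ 2 = -q * q ^ (2 * r + 1 + 1) by ring, sub_neg_eq_add]
  field_simp
  ring

theorem baileySum_inv_one {q : ℂ} (hq0 : q ≠ 0) (hq : ‖q‖ < 1) (r : ℕ) :
    baileySum q q⁻¹ 1 r = qPochInf (-q ^ 3) (q ^ 2) / qPochInf (q ^ 2) (q ^ 2) *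
      ((1 + q ^ (2 * (r : ℤ) + 1)) * q ^ ((r : ℤ) ^ 2)) := by
  have h2 := norm_pow_lt_one hq two_ne_zero
  have h := qPochInf_neg_shift hq 3 r
  have e1 : (q : ℂ) ^ ((r : ℤ) ^ 2) = q⁻¹ ^ r * q ^ (r ^ 2 + 1 * r) := by
    rw [← Nat.cast_pow, zpow_natCast, one_mul, pow_add, inv_pow]
    field_simp
  have e2 : (q : ℂ) ^ (2 * (r : ℤ) + 1) = q ^ (2 * r + 1) := by
    rw [← zpow_natCast]; push_cast; rfl
  have e3 : -q⁻¹ * q ^ (2 * r + 1 + 1) = -q ^ (2 * r + 1) := by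
    rw [pow_succ _ (2 * r + 1)]; field_simp
  have e4 : -q ^ (1 + 1) / q⁻¹ = -q ^ 3 := by field_simp
  rw [baileySum_natCast hq (inv_ne_zero hq0), baileyWeight, ← h, e1, e2, e3, e4,
    qPochInf_succ h2 (-q ^ (2 * r + 1)),
    show -q ^ (2 * r + 1) * q ^ 2 = -q ^ (2 * r + 3) by ring, sub_neg_eq_add]
  ring

/-! ### The two halves of the two families -/

theorem nahmHalf_inv_zero {q : ℂ} (hq0 : q ≠ 0) (hq : ‖q‖ < 1) {u : ℂ} (hu : u ≠ 0) (w : ℂ) :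
    nahmHalf u u⁻¹ w 1 q 0 = qPochInf (-u * q) (q ^ 2) * qPochInf (-u⁻¹ * q) (q ^ 2) *
      qPochInf (-w * q) (q ^ 2) *
      ∑' n : ℕ, baileyWeight q w 0 n * bilatSum q n (n + (0 : ℕ))
        fun r => u ^ r * q ^ (r ^ 2) := by
  have e (x : ℂ) : -x * q / q ^ 0 = -x * q := by simp
  rw [nahmHalf, e, e, e, ← tsum_mul_left, ← tsum_mul_left]
  refine tsum_congr fun n => ?_
  rw [Nat.cast_zero, add_zero (n : ℤ), add_zero (2 * n), bilatSum_triple hq0 hq n u hu, baileyWeight,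
    show -q ^ (1 + 0) / u⁻¹ = -u * q by rw [add_zero, pow_one]; field_simp,
    show -q ^ (1 + 0) / u = -q / u by simp, show u * u⁻¹ * w * 1 ^ 2 = w by field_simp]
  ring

/-- The finite triple product of odd length needs n + 1 factors in 1/u, so the first factor 1 + 1/u
is taken from the infinite product (-1/u; p)_∞. -/
theorem nahmHalf_inv_one {q : ℂ} (hq0 : q ≠ 0) (hq : ‖q‖ < 1) {u : ℂ} (hu : u ≠ 0) (w : ℂ) :
    nahmHalf u u⁻¹ w 1 q 1 = q * qPochInf (-u) (q ^ 2) * qPochInf (-u⁻¹ * q ^ 2) (q ^ 2) *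
      qPochInf (-w) (q ^ 2) *
      ∑' n : ℕ, baileyWeight q w 1 n * bilatSum q n (n + (1 : ℕ))
        fun r => u ^ r * q ^ (r ^ 2 + r) := by
  have h2 := norm_pow_lt_one hq two_ne_zero
  have e (x : ℂ) : -x * q / q ^ 1 = -x := by field_simp
  rw [nahmHalf, e, e, e, qPochInf_succ h2 (-u⁻¹), ← tsum_mul_left, ← tsum_mul_left]
  refine tsum_congr fun n => ?_
  rw [Nat.cast_one, bilatSum_triple_odd hq0 hq n hu, baileyWeight, qPoch_succ',
    show -q ^ (1 + 1) / u⁻¹ = -u * q ^ 2 by field_simp,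
    show -1 / u * q ^ 2 = -q ^ (1 + 1) / u by ring,
    show u * u⁻¹ * w * 1 ^ 2 = w by field_simp,
    show -1 / u = -u⁻¹ by ring]
  ring

theorem qPoch_neg_double (q : ℂ) (n : ℕ) :
    qPoch (-q) q (2 * n) = qPoch (-q) (q ^ 2) n * qPoch (-q ^ 2) (q ^ 2) n := by
  rw [qPoch_mul_length]
  simp [Finset.prod_range_succ, ← pow_two]

/-- The parameters q^(-1) and 1 give (-q^2; p)_n (-q; p)_n = (-q; q)_(2n), which reduces 1 / (p;
p)_(2n) to 1 / (q; q)_(2n). The choice t^2 = q makes the base of the n-th power equal to u, as the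
weight requires. -/
theorem nahmHalf_self_inv_zero {q : ℂ} (hq0 : q ≠ 0) (hq : ‖q‖ < 1) {u : ℂ} (hu : u ≠ 0)
    {h : ℂ} (hh : h ^ 2 = q) :
    nahmHalf u q⁻¹ 1 h q 0 = qPochInf (-u * q) (q ^ 2) * qPochInf (-1) (q ^ 2) *
      qPochInf (-q) (q ^ 2) *
      ∑' n : ℕ, baileyWeight q u 0 n * bilatSum q n (n + (0 : ℕ)) fun r => q ^ (2 * r ^ 2 + r) := by
  have hnq : ‖-q‖ < 1 := by rwa [norm_neg]
  rw [nahmHalf, ← tsum_mul_left, ← tsum_mul_left]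
  refine tsum_congr fun n => ?_
  have h3 := qPoch_mul_neg q q (2 * n)
  rw [qPoch_neg_double] at h3
  have h4 := qPoch_ne_zero_of_norm hq hq (2 * n)
  have h5 : qPoch (-q) (q ^ 2) n ≠ 0 :=
    qPoch_ne_zero_of_norm (norm_pow_lt_one hq two_ne_zero) hnq n
  have h6 : qPoch (-q ^ 2) (q ^ 2) n ≠ 0 :=
    qPoch_ne_zero_of_norm (norm_pow_lt_one hq two_ne_zero)
      (by rw [norm_neg]; exact norm_pow_lt_one hq two_ne_zero) n
  rw [Nat.cast_zero, add_zero (n : ℤ), add_zero (2 * n), bilatSum_triangular hq0 hq n, baileyWeight,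
    qFactInv_natCast, ← h3, hh, show -q ^ (1 + 0) / q⁻¹ = -q ^ 2 by rw [add_zero, pow_one]; field_simp,
    show -q ^ (1 + 0) / 1 = -q by simp, show u * q⁻¹ * 1 * q = u by field_simp,
    show -u * q / q ^ 0 = -u * q by simp, show -q⁻¹ * q / q ^ 0 = -1 by field_simp,
    show -1 * q / q ^ 0 = -q by simp]
  field_simp
  ring

theorem nahmHalf_self_inv_one {q : ℂ} (hq0 : q ≠ 0) (hq : ‖q‖ < 1) {u : ℂ} (hu : u ≠ 0)
    {h : ℂ} (hh : h ^ 2 = q) :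
    nahmHalf u q⁻¹ 1 h q 1 = h * qPochInf (-u) (q ^ 2) * qPochInf (-q) (q ^ 2) *
      qPochInf (-1) (q ^ 2) *
      ∑' n : ℕ, baileyWeight q u 1 n * bilatSum q n (n + (1 : ℕ)) fun r => q ^ (2 * r ^ 2 + r) := by
  have h2 := norm_pow_lt_one hq two_ne_zero
  have hnq : ‖-q‖ < 1 := by rwa [norm_neg]
  have e (x : ℂ) : -x * q / q ^ 1 = -x := by field_simp
  rw [nahmHalf, e, e, e, ← tsum_mul_left, ← tsum_mul_left]
  refine tsum_congr fun n => ?_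
  have h3 := qPoch_mul_neg q q (2 * n + 1)
  -- The additional factor 1 + q is matched by h q (1 + q^(-1)) from the prefactor, where 1 + q^(-1)
  -- opens (-q^(-1); p)_∞.
  have h7 : qPoch (-q) q (2 * n + 1) =
      (1 + q) * (qPoch (-q ^ 3) (q ^ 2) n * qPoch (-q ^ 2) (q ^ 2) n) := by
    rw [qPoch_succ, qPoch_neg_double, pow_mul]
    have h8 := qPoch_succ (-q) (q ^ 2) n
    rw [qPoch_succ', show -q * q ^ 2 = -q ^ 3 by ring] at h8
    linear_combination -qPoch (-q ^ 2) (q ^ 2) n * h8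
  rw [h7] at h3
  have h4 := qPoch_ne_zero_of_norm hq hq (2 * n + 1)
  have h5 : qPoch (-q ^ 3) (q ^ 2) n ≠ 0 :=
    qPoch_ne_zero_of_norm h2 (by rw [norm_neg]; exact norm_pow_lt_one hq three_ne_zero) n
  have h6 : qPoch (-q ^ 2) (q ^ 2) n ≠ 0 :=
    qPoch_ne_zero_of_norm h2 (by rwa [norm_neg]) n
  have h9 := one_add_ne_zero_of_norm hq
  rw [Nat.cast_one, bilatSum_triangular_odd hq0 hq n, baileyWeight, qFactInv_natCast, ← h3, hh,
    qPochInf_succ h2 (-q⁻¹), show -q⁻¹ * q ^ 2 = -q by field_simp,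
    show -q ^ (1 + 1) / q⁻¹ = -q ^ 3 by field_simp, show -q ^ (1 + 1) / 1 = -q ^ 2 by simp,
    show u * q⁻¹ * 1 * q = u by field_simp]
  field_simp
  ring

/-! ### Theta series -/

/-- The theta series `∑ z ^ r q ^ (r²)` over the integers. -/
def thetaSeries (z q : ℂ) : ℂ := ∑' r : ℤ, z ^ r * q ^ (r ^ 2)

theorem summable_norm_zpow_mul_zpow_sq_add {q : ℂ} (hq0 : q ≠ 0) (hq : ‖q‖ < 1) (u : ℂ) :
    Summable fun r : ℤ => ‖u ^ r * q ^ (r ^ 2 + r)‖ := by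
  refine (summable_norm_zpow_mul_zpow_sq hq (u * q)).congr fun r => ?_
  rw [mul_zpow, zpow_add₀ hq0]
  congr 1; ring

theorem summable_norm_zpow_triangular {q : ℂ} (hq0 : q ≠ 0) (hq : ‖q‖ < 1) :
    Summable fun r : ℤ => ‖q ^ (2 * r ^ 2 + r)‖ := by
  refine (summable_norm_zpow_mul_zpow_sq (norm_pow_lt_one hq two_ne_zero) q).congr fun r => ?_
  rw [← zpow_natCast q 2, ← zpow_mul, ← zpow_add₀ hq0]
  congr 2; push_cast; ring

theorem pow_zpow_mul_pow_zpow {q : ℂ} (hq0 : q ≠ 0) (a m : ℕ) {r k : ℤ}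
    (h : a * r + m * r ^ 2 = k) : (q ^ a) ^ r * (q ^ m) ^ (r ^ 2) = q ^ k := by
  rw [← zpow_natCast, ← zpow_natCast, ← zpow_mul, ← zpow_mul, ← zpow_add₀ hq0, h]

theorem thetaSeries_pow {q : ℂ} (hq0 : q ≠ 0) (a m : ℕ) :
    thetaSeries (q ^ a) (q ^ m) = ∑' r : ℤ, q ^ (a * r + m * r ^ 2) :=
  tsum_congr fun _ => pow_zpow_mul_pow_zpow hq0 a m rfl

theorem summable_thetaSeries_pow {q : ℂ} (hq0 : q ≠ 0) (hq : ‖q‖ < 1) (a : ℕ) {m : ℕ}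
    (hm : m ≠ 0) : Summable fun r : ℤ => q ^ (a * r + m * r ^ 2) := by
  refine (summable_norm_zpow_mul_zpow_sq (norm_pow_lt_one hq hm) (q ^ a)).of_norm.congr fun r => ?_
  exact pow_zpow_mul_pow_zpow hq0 a m rfl

theorem thetaSeries_eq {q : ℂ} (hq0 : q ≠ 0) (hq : ‖q‖ < 1) {z : ℂ} (hz : z ≠ 0) :
    thetaSeries z q =
      qPochInf (-z * q) (q ^ 2) * qPochInf (-q / z) (q ^ 2) * qPochInf (q ^ 2) (q ^ 2) :=
  tsum_zpow_mul_zpow_sq hq0 hq hz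

/-- A theta series symmetrized under `r ↦ -r - δ`. -/
theorem tsum_add_reflect {f : ℤ → ℂ} (hf : Summable f) (δ : ℤ) :
    ∑' r, (f r + f (-r - δ)) = 2 * ∑' r, f r := by
  have e : (fun r => f (-r - δ)) = fun r => f (Equiv.subLeft (-δ) r) := by
    funext r
    rw [Equiv.subLeft_apply, show -δ - r = -r - δ by ring]
  have h : ∑' r, f (-r - δ) = ∑' r, f r := by
    rw [e]; exact (Equiv.subLeft (-δ)).tsum_eq f
  have hs : Summable fun r => f (-r - δ) := by
    rw [e]; exact (Equiv.subLeft (-δ)).summable_iff.mpr hf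
  rw [hf.tsum_add hs, h, two_mul]

/-! ### Weighted series as theta series -/

theorem tsum_triple_one_zero {q : ℂ} (hq : ‖q‖ < 1) (u : ℂ) :
    ∑' n : ℕ, baileyWeight q 1 0 n * bilatSum q n (n + (0 : ℕ)) (fun r => u ^ r * q ^ (r ^ 2)) =
      qPochInf (-q) (q ^ 2) / qPochInf (q ^ 2) (q ^ 2) * thetaSeries u (q ^ 2) := by
  rw [tsum_baileyWeight_mul_bilatSum hq 1 zero_le_one (summable_norm_zpow_mul_zpow_sq hq u)
    (τ := fun r => q ^ (r ^ 2)) (by intro r; simp) (baileySum_one_zero hq), thetaSeries]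
  congr 1
  refine tsum_congr fun r => ?_
  rw [pow_two q, mul_zpow]
  ring

theorem tsum_triple_one_one {q : ℂ} (hq0 : q ≠ 0) (hq : ‖q‖ < 1) (u : ℂ) :
    ∑' n : ℕ, baileyWeight q 1 1 n *
        bilatSum q n (n + (1 : ℕ)) (fun r => u ^ r * q ^ (r ^ 2 + r)) =
      qPochInf (-q ^ 2) (q ^ 2) / qPochInf (q ^ 2) (q ^ 2) *
        thetaSeries (u * q ^ 2) (q ^ 2) := by
  rw [tsum_baileyWeight_mul_bilatSum hq 1 le_rfl (summable_norm_zpow_mul_zpow_sq_add hq0 hq u)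
    (τ := fun r => q ^ (r ^ 2 + r)) (by intro r; congr 1; push_cast; ring)
    (baileySum_one_one hq), thetaSeries]
  congr 1
  refine tsum_congr fun r => ?_
  rw [pow_two q, mul_zpow, mul_zpow, mul_zpow, zpow_add₀ hq0]
  ring

/-- For w = q the weight has denominator 1 + q^(2r+δ). It cancels only after the coefficients at r
and -r - δ are added, since their sum contains that factor; hence the symmetrized form and the
factor 1/2. The same happens in the other series with w = q. -/
theorem tsum_triple_self_zero {q : ℂ} (hq0 : q ≠ 0) (hq : ‖q‖ < 1) :
    ∑' n : ℕ, baileyWeight q q 0 n * bilatSum q n (n + (0 : ℕ)) (fun r => q ^ r * q ^ (r ^ 2)) =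
      qPochInf (-1) (q ^ 2) / qPochInf (q ^ 2) (q ^ 2) / 2 * thetaSeries (q ^ 0) (q ^ 2) := by
  rw [tsum_baileyWeight_mul_bilatSum_symm hq q zero_le_one (summable_norm_zpow_mul_zpow_sq hq q)
    (τ := fun r => q ^ (r ^ 2 + r) / (1 + q ^ (2 * r))) ?_ (baileySum_self_zero hq0 hq),
    thetaSeries_pow hq0]
  · congr 1
    refine tsum_congr fun r => ?_
    have h := one_add_zpow_ne_zero hq (2 * r)
    rw [mul_div_assoc', div_eq_iff h]
    simp only [add_mul, mul_add, mul_one, ← zpow_add₀ hq0]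
    rw [add_comm]
    congr 2 <;> push_cast <;> ring
  · intro r
    have h := one_add_zpow_ne_zero hq (2 * r)
    have h' := one_add_zpow_ne_zero hq (2 * (-r - (0 : ℕ)))
    rw [div_eq_div_iff h' h]
    simp only [mul_add, mul_one, ← zpow_add₀ hq0]
    rw [add_comm]
    congr 2 <;> push_cast <;> ring

theorem tsum_triple_self_one {q : ℂ} (hq0 : q ≠ 0) (hq : ‖q‖ < 1) :
    ∑' n : ℕ, baileyWeight q q 1 n *
        bilatSum q n (n + (1 : ℕ)) (fun r => q ^ r * q ^ (r ^ 2 + r)) =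
      qPochInf (-q) (q ^ 2) / qPochInf (q ^ 2) (q ^ 2) / 2 *
        (q⁻¹ * thetaSeries (q ^ 2) (q ^ 2)) := by
  rw [tsum_baileyWeight_mul_bilatSum_symm hq q le_rfl (summable_norm_zpow_mul_zpow_sq_add hq0 hq q)
    (τ := fun r => q ^ (r ^ 2 + 2 * r) / (1 + q ^ (2 * r + 1))) ?_ (baileySum_self_one hq0 hq),
    thetaSeries_pow hq0, ← tsum_mul_left (a := q⁻¹)]
  · congr 1
    refine tsum_congr fun r => ?_
    have h := one_add_zpow_ne_zero hq (2 * r + 1)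
    rw [mul_div_assoc', div_eq_iff h, ← zpow_neg_one]
    simp only [add_mul, mul_add, mul_one, ← zpow_add₀ hq0]
    rw [add_comm]
    congr 2 <;> push_cast <;> ring
  · intro r
    have h := one_add_zpow_ne_zero hq (2 * r + 1)
    have h' := one_add_zpow_ne_zero hq (2 * (-r - (1 : ℕ)) + 1)
    rw [div_eq_div_iff h' h]
    simp only [mul_add, mul_one, ← zpow_add₀ hq0]
    rw [add_comm]
    congr 2 <;> push_cast <;> ring

/-- For w = q^(-1) the numerator 1 + q^(2r+δ) splits the series into a theta series and its
reflection under r ↦ -r - δ, whence the factor 2. -/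
theorem tsum_triple_inv_zero {q : ℂ} (hq0 : q ≠ 0) (hq : ‖q‖ < 1) :
    ∑' n : ℕ, baileyWeight q q⁻¹ 0 n *
        bilatSum q n (n + (0 : ℕ)) (fun r => (1 : ℂ) ^ r * q ^ (r ^ 2)) =
      qPochInf (-q ^ 2) (q ^ 2) / qPochInf (q ^ 2) (q ^ 2) *
        (2 * thetaSeries (q ^ 1) (q ^ 2)) := by
  rw [tsum_baileyWeight_mul_bilatSum hq q⁻¹ zero_le_one (summable_norm_zpow_mul_zpow_sq hq 1)
    (τ := fun r => (1 + q ^ (2 * r)) * q ^ (r ^ 2 - r)) ?_ (baileySum_inv_zero hq0 hq),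
    thetaSeries_pow hq0, ← tsum_add_reflect (summable_thetaSeries_pow hq0 hq 1 two_ne_zero) 0]
  · congr 1
    refine tsum_congr fun r => ?_
    simp only [one_zpow, one_mul, add_mul, mul_add, ← zpow_add₀ hq0]
    rw [add_comm]
    congr 2 <;> push_cast <;> ring
  · intro r
    simp only [add_mul, one_mul, ← zpow_add₀ hq0]
    rw [add_comm]
    congr 2 <;> push_cast <;> ring

theorem tsum_triple_inv_one {q : ℂ} (hq0 : q ≠ 0) (hq : ‖q‖ < 1) :
    ∑' n : ℕ, baileyWeight q q⁻¹ 1 n *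
        bilatSum q n (n + (1 : ℕ)) (fun r => (1 : ℂ) ^ r * q ^ (r ^ 2 + r)) =
      qPochInf (-q ^ 3) (q ^ 2) / qPochInf (q ^ 2) (q ^ 2) *
        (2 * thetaSeries (q ^ 1) (q ^ 2)) := by
  rw [tsum_baileyWeight_mul_bilatSum hq q⁻¹ le_rfl (summable_norm_zpow_mul_zpow_sq_add hq0 hq 1)
    (τ := fun r => (1 + q ^ (2 * r + 1)) * q ^ (r ^ 2)) ?_ (baileySum_inv_one hq0 hq),
    thetaSeries_pow hq0, ← tsum_add_reflect (summable_thetaSeries_pow hq0 hq 1 two_ne_zero) 1]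
  · congr 1
    refine tsum_congr fun r => ?_
    simp only [one_zpow, one_mul, add_mul, mul_add, ← zpow_add₀ hq0]
    congr 2 <;> push_cast <;> ring
  · intro r
    simp only [add_mul, one_mul, ← zpow_add₀ hq0]
    rw [add_comm]
    congr 2 <;> push_cast <;> ring

theorem tsum_triangular_self_zero {q : ℂ} (hq0 : q ≠ 0) (hq : ‖q‖ < 1) :
    ∑' n : ℕ, baileyWeight q q 0 n * bilatSum q n (n + (0 : ℕ)) (fun r => q ^ (2 * r ^ 2 + r)) =
      qPochInf (-1) (q ^ 2) / qPochInf (q ^ 2) (q ^ 2) / 2 * thetaSeries (q ^ 0) (q ^ 3) := by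
  rw [tsum_baileyWeight_mul_bilatSum_symm hq q zero_le_one (summable_norm_zpow_triangular hq0 hq)
    (τ := fun r => q ^ (r ^ 2 + r) / (1 + q ^ (2 * r))) ?_ (baileySum_self_zero hq0 hq),
    thetaSeries_pow hq0]
  · congr 1
    refine tsum_congr fun r => ?_
    have h := one_add_zpow_ne_zero hq (2 * r)
    rw [mul_div_assoc', div_eq_iff h]
    simp only [add_mul, mul_add, mul_one, ← zpow_add₀ hq0]
    rw [add_comm]
    congr 2 <;> push_cast <;> ring
  · intro r
    have h := one_add_zpow_ne_zero hq (2 * r)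
    have h' := one_add_zpow_ne_zero hq (2 * (-r - (0 : ℕ)))
    rw [div_eq_div_iff h' h]
    simp only [mul_add, mul_one, ← zpow_add₀ hq0]
    rw [add_comm]
    congr 2 <;> push_cast <;> ring

theorem tsum_triangular_self_one {q : ℂ} (hq0 : q ≠ 0) (hq : ‖q‖ < 1) :
    ∑' n : ℕ, baileyWeight q q 1 n * bilatSum q n (n + (1 : ℕ)) (fun r => q ^ (2 * r ^ 2 + r)) =
      qPochInf (-q) (q ^ 2) / qPochInf (q ^ 2) (q ^ 2) / 2 * thetaSeries (q ^ 3) (q ^ 3) := by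
  rw [tsum_baileyWeight_mul_bilatSum_symm hq q le_rfl (summable_norm_zpow_triangular hq0 hq)
    (τ := fun r => q ^ (r ^ 2 + 2 * r) / (1 + q ^ (2 * r + 1))) ?_ (baileySum_self_one hq0 hq),
    thetaSeries_pow hq0]
  · congr 1
    refine tsum_congr fun r => ?_
    have h := one_add_zpow_ne_zero hq (2 * r + 1)
    rw [mul_div_assoc', div_eq_iff h]
    simp only [add_mul, mul_add, mul_one, ← zpow_add₀ hq0]
    congr 2 <;> push_cast <;> ring
  · intro r
    have h := one_add_zpow_ne_zero hq (2 * r + 1)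
    have h' := one_add_zpow_ne_zero hq (2 * (-r - (1 : ℕ)) + 1)
    rw [div_eq_div_iff h' h]
    simp only [mul_add, mul_one, ← zpow_add₀ hq0]
    rw [add_comm]
    congr 2 <;> push_cast <;> ring

theorem tsum_triangular_one_zero {q : ℂ} (hq0 : q ≠ 0) (hq : ‖q‖ < 1) :
    ∑' n : ℕ, baileyWeight q 1 0 n * bilatSum q n (n + (0 : ℕ)) (fun r => q ^ (2 * r ^ 2 + r)) =
      qPochInf (-q) (q ^ 2) / qPochInf (q ^ 2) (q ^ 2) * thetaSeries (q ^ 1) (q ^ 3) := by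
  rw [tsum_baileyWeight_mul_bilatSum hq 1 zero_le_one (summable_norm_zpow_triangular hq0 hq)
    (τ := fun r => q ^ (r ^ 2)) (by intro r; simp) (baileySum_one_zero hq), thetaSeries_pow hq0]
  congr 1
  refine tsum_congr fun r => ?_
  rw [← zpow_add₀ hq0]
  congr 1; push_cast; ring

theorem tsum_triangular_one_one {q : ℂ} (hq0 : q ≠ 0) (hq : ‖q‖ < 1) :
    ∑' n : ℕ, baileyWeight q 1 1 n * bilatSum q n (n + (1 : ℕ)) (fun r => q ^ (2 * r ^ 2 + r)) =
      qPochInf (-q ^ 2) (q ^ 2) / qPochInf (q ^ 2) (q ^ 2) * thetaSeries (q ^ 2) (q ^ 3) := by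
  rw [tsum_baileyWeight_mul_bilatSum hq 1 le_rfl (summable_norm_zpow_triangular hq0 hq)
    (τ := fun r => q ^ (r ^ 2 + r)) (by intro r; congr 1; push_cast; ring)
    (baileySum_one_one hq), thetaSeries_pow hq0]
  congr 1
  refine tsum_congr fun r => ?_
  rw [← zpow_add₀ hq0]
  congr 1; push_cast; ring

/-! ### Eta quotients -/

theorem qJ_ne_zero {q : ℂ} (hq : ‖q‖ < 1) {m : ℕ} (hm : m ≠ 0) : qJ q m ≠ 0 :=
  qPochInf_ne_zero_of_norm (norm_pow_lt_one hq hm) (norm_pow_lt_one hq hm)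

theorem qPochInf_split_two {q : ℂ} (hq : ‖q‖ < 1) (a : ℂ) :
    qPochInf a q = qPochInf a (q ^ 2) * qPochInf (a * q) (q ^ 2) := by
  rw [qPochInf_eq_prod hq a two_ne_zero]
  simp [Finset.prod_range_succ]

theorem qPochInf_split_three {q : ℂ} (hq : ‖q‖ < 1) (a : ℂ) :
    qPochInf a q =
      qPochInf a (q ^ 3) * qPochInf (a * q) (q ^ 3) * qPochInf (a * q ^ 2) (q ^ 3) := by
  rw [qPochInf_eq_prod hq a three_ne_zero]
  simp [Finset.prod_range_succ]

theorem qPochInf_neg_self {q : ℂ} (hq : ‖q‖ < 1) {m : ℕ} (hm : m ≠ 0) :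
    qPochInf (-q ^ m) (q ^ m) = qJ q (2 * m) / qJ q m := by
  rw [eq_div_iff (qJ_ne_zero hq hm), mul_comm, qJ, qPochInf_mul_neg (norm_pow_lt_one hq hm),
    ← pow_mul, mul_comm m, qJ]

theorem qPochInf_neg_one {q : ℂ} (hq : ‖q‖ < 1) {m : ℕ} (hm : m ≠ 0) :
    qPochInf (-1) (q ^ m) = 2 * (qJ q (2 * m) / qJ q m) := by
  rw [qPochInf_succ (norm_pow_lt_one hq hm), neg_one_mul, qPochInf_neg_self hq hm]
  norm_num

theorem qPochInf_self_double {q : ℂ} (hq : ‖q‖ < 1) {m : ℕ} (hm : m ≠ 0) :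
    qPochInf (q ^ m) (q ^ (2 * m)) = qJ q m / qJ q (2 * m) := by
  rw [eq_div_iff (qJ_ne_zero hq (by omega)), qJ, qJ,
    qPochInf_split_two (norm_pow_lt_one hq hm) (q ^ m), ← pow_add, ← pow_mul, mul_comm m 2,
    two_mul m]

theorem qPochInf_neg_double {q : ℂ} (hq : ‖q‖ < 1) {m : ℕ} (hm : m ≠ 0) :
    qPochInf (-q ^ m) (q ^ (2 * m)) = qJ q (2 * m) ^ 2 / (qJ q m * qJ q (4 * m)) := by
  have h := qPochInf_mul_neg (norm_pow_lt_one hq (by omega : 2 * m ≠ 0)) (q ^ m)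
  have h2 := qPochInf_self_double hq (by omega : 2 * m ≠ 0)
  have n1 := qJ_ne_zero hq hm
  have n2 := qJ_ne_zero hq (by omega : 2 * m ≠ 0)
  have n4 := qJ_ne_zero hq (by omega : 4 * m ≠ 0)
  rw [qPochInf_self_double hq hm, ← pow_mul, ← pow_mul, mul_comm m 2, mul_comm (2 * m) 2, h2,
    show 2 * (2 * m) = 4 * m by ring] at h
  field_simp at h ⊢
  linear_combination h

/-! ### Theta products as eta quotients -/

theorem thetaSeries_zero_two {q : ℂ} (hq0 : q ≠ 0) (hq : ‖q‖ < 1) :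
    thetaSeries (q ^ 0) (q ^ 2) = (qJ q 4 ^ 2 / (qJ q 2 * qJ q 8)) ^ 2 * qJ q 4 := by
  have h := qPochInf_neg_double hq two_ne_zero
  rw [thetaSeries_eq (pow_ne_zero 2 hq0) (norm_pow_lt_one hq two_ne_zero) (pow_ne_zero 0 hq0),
    ← pow_mul, pow_zero, neg_one_mul, div_one, h, qJ]
  ring

theorem thetaSeries_two_two {q : ℂ} (hq0 : q ≠ 0) (hq : ‖q‖ < 1) :
    thetaSeries (q ^ 2) (q ^ 2) = 2 * (qJ q 8 / qJ q 4) ^ 2 * qJ q 4 := by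
  have h2 := pow_ne_zero 2 hq0
  rw [thetaSeries_eq h2 (norm_pow_lt_one hq two_ne_zero) h2, ← pow_mul, neg_mul, ← pow_add,
    neg_div, div_self h2, qPochInf_neg_self hq (by norm_num), qPochInf_neg_one hq (by norm_num)]
  simp only [qJ]
  ring

theorem thetaSeries_one_two {q : ℂ} (hq0 : q ≠ 0) (hq : ‖q‖ < 1) :
    thetaSeries (q ^ 1) (q ^ 2) = qJ q 2 ^ 2 / (qJ q 1 * qJ q 4) * qJ q 4 := by
  have h := qPochInf_neg_double hq one_ne_zero
  rw [qPochInf_split_two (norm_pow_lt_one hq (by norm_num))] at h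
  rw [thetaSeries_eq (pow_ne_zero 2 hq0) (norm_pow_lt_one hq two_ne_zero) (pow_ne_zero 1 hq0),
    show -q ^ 1 * q ^ 2 = -q ^ 1 * q ^ (2 * 1) by ring,
    show -q ^ 2 / q ^ 1 = -q ^ 1 by field_simp,
    show (q ^ 2) ^ 2 = (q ^ (2 * 1)) ^ 2 by ring, mul_comm (qPochInf _ _), h]
  norm_num [qJ, ← pow_mul]

theorem thetaSeries_zero_three {q : ℂ} (hq0 : q ≠ 0) (hq : ‖q‖ < 1) :
    thetaSeries (q ^ 0) (q ^ 3) = (qJ q 6 ^ 2 / (qJ q 3 * qJ q 12)) ^ 2 * qJ q 6 := by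
  have h := qPochInf_neg_double hq three_ne_zero
  rw [thetaSeries_eq (pow_ne_zero 3 hq0) (norm_pow_lt_one hq three_ne_zero) (pow_ne_zero 0 hq0),
    ← pow_mul, mul_comm 3 2, pow_zero, neg_one_mul, div_one, h, qJ]
  ring

theorem thetaSeries_three_three {q : ℂ} (hq0 : q ≠ 0) (hq : ‖q‖ < 1) :
    thetaSeries (q ^ 3) (q ^ 3) = 2 * (qJ q 12 / qJ q 6) ^ 2 * qJ q 6 := by
  have h3 := pow_ne_zero 3 hq0
  rw [thetaSeries_eq h3 (norm_pow_lt_one hq three_ne_zero) h3, ← pow_mul, neg_mul, ← pow_add,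
    neg_div, div_self h3, qPochInf_neg_self hq (by norm_num), qPochInf_neg_one hq (by norm_num)]
  simp only [qJ]
  ring

/-- The products (-q^2; q^6)_∞ and (-q^4; q^6)_∞ make up (-q^2; q^2)_∞ without the multiples of 6.
The neighbouring evaluations at `q ^ 2` and of `qJ₂ q 2 12` split (-q; q^2)_∞ and (q^2; q^4)_∞
modulo three in the same way. -/
theorem thetaSeries_one_three {q : ℂ} (hq0 : q ≠ 0) (hq : ‖q‖ < 1) :
    thetaSeries (q ^ 1) (q ^ 3) = qJ q 4 * qJ q 6 / (qJ q 2 * qJ q 12) * qJ q 6 := by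
  have h := qPochInf_neg_self hq two_ne_zero
  have h6 := qPochInf_neg_self hq (by norm_num : 6 ≠ 0)
  rw [qPochInf_split_three (norm_pow_lt_one hq two_ne_zero), ← pow_mul, neg_mul, ← pow_add, neg_mul,
    ← pow_mul, ← pow_add] at h
  norm_num only at h h6
  rw [h6] at h
  have n6 := qJ_ne_zero hq (by norm_num : 6 ≠ 0)
  have n12 := qJ_ne_zero hq (by norm_num : 12 ≠ 0)
  have n2 := qJ_ne_zero hq two_ne_zero
  rw [thetaSeries_eq (pow_ne_zero 3 hq0) (norm_pow_lt_one hq three_ne_zero) (pow_ne_zero 1 hq0),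
    show -q ^ 1 * q ^ 3 = -q ^ 4 by ring, show -q ^ 3 / q ^ 1 = -q ^ 2 by field_simp,
    ← pow_mul, ← qJ]
  norm_num only
  congr 1
  field_simp at h ⊢
  linear_combination h

theorem thetaSeries_two_three {q : ℂ} (hq0 : q ≠ 0) (hq : ‖q‖ < 1) :
    thetaSeries (q ^ 2) (q ^ 3) =
      qJ q 2 ^ 2 * qJ q 3 * qJ q 12 / (qJ q 1 * qJ q 4 * qJ q 6 ^ 2) * qJ q 6 := by
  have h := qPochInf_neg_double hq one_ne_zero
  have h3 := qPochInf_neg_double hq three_ne_zero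
  rw [qPochInf_split_three (norm_pow_lt_one hq (by norm_num)), ← pow_mul, neg_mul, ← pow_add,
    neg_mul, ← pow_mul, ← pow_add] at h
  norm_num only at h h3
  rw [h3] at h
  have n6 := qJ_ne_zero hq (by norm_num : 6 ≠ 0)
  have n12 := qJ_ne_zero hq (by norm_num : 12 ≠ 0)
  have n1 := qJ_ne_zero hq one_ne_zero
  have n4 := qJ_ne_zero hq four_ne_zero
  have n3 := qJ_ne_zero hq three_ne_zero
  rw [thetaSeries_eq (pow_ne_zero 3 hq0) (norm_pow_lt_one hq three_ne_zero) (pow_ne_zero 2 hq0),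
    show -q ^ 2 * q ^ 3 = -q ^ 5 by ring, show -q ^ 3 / q ^ 2 = -q ^ 1 by field_simp,
    ← pow_mul, ← qJ]
  norm_num only
  congr 1
  field_simp at h ⊢
  linear_combination h

theorem qJ₂_two_twelve {q : ℂ} (hq : ‖q‖ < 1) :
    qJ₂ q 2 12 = qJ q 2 * qJ q 12 / (qJ q 4 * qJ q 6) * qJ q 12 := by
  have h := qPochInf_self_double hq two_ne_zero
  have h3 := qPochInf_self_double hq (by norm_num : 6 ≠ 0)
  rw [qPochInf_split_three (norm_pow_lt_one hq (by norm_num)), ← pow_mul, ← pow_add,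
    ← pow_mul, ← pow_add] at h
  norm_num only at h h3
  rw [h3] at h
  have n6 := qJ_ne_zero hq (by norm_num : 6 ≠ 0)
  have n12 := qJ_ne_zero hq (by norm_num : 12 ≠ 0)
  have n4 := qJ_ne_zero hq four_ne_zero
  have e : q ^ (((12 : ℕ) : ℤ) - ((2 : ℕ) : ℤ)) = q ^ 10 := by
    rw [← zpow_natCast]; norm_num
  rw [qJ₂, e, ← qJ]
  congr 1
  field_simp at h ⊢
  linear_combination h

theorem qJ₂_eq_thetaSeries {q : ℂ} (hq0 : q ≠ 0) (hq : ‖q‖ < 1) {a b m : ℕ} (hm : m ≠ 0)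
    (h : a + b = m) : qJ₂ q a (2 * m) = thetaSeries (-q ^ b) (q ^ m) := by
  have e : q ^ (((2 * m : ℕ) : ℤ) - (a : ℤ)) = - -q ^ b * q ^ m := by
    rw [neg_neg, ← pow_add, ← zpow_natCast]; congr 1; push_cast; omega
  have e2 : -q ^ m / -q ^ b = q ^ a := by
    rw [neg_div_neg_eq, ← h, pow_add, mul_div_cancel_right₀ _ (pow_ne_zero b hq0)]
  rw [thetaSeries_eq (pow_ne_zero m hq0) (norm_pow_lt_one hq hm)
    (neg_ne_zero.mpr (pow_ne_zero b hq0)), qJ₂, e, e2, ← pow_mul, mul_comm m 2]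
  ring

/-- Odd integers are written as -2k - 1 so that r + 3r^2 becomes 2(6k^2 + 5k + 1), which matches the
theta series with parameter -q^5 directly. -/
theorem tsum_int_even_add_odd {f : ℤ → ℂ} (hf : Summable f) :
    ∑' r, f r = ∑' k, f (2 * k) + ∑' k, f (-2 * k - 1) := by
  have he : Function.Injective fun k : ℤ => 2 * k := fun a b h => by simp only at h; omega
  have ho : Function.Injective fun k : ℤ => -2 * k - 1 := fun a b h => by simp only at h; omega
  have h1 := he.hasSum_range_iff.mpr (hf.comp_injective he).hasSum
  have h2 := ho.hasSum_range_iff.mpr (hf.comp_injective ho).hasSum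
  have hc : IsCompl (Set.range fun k : ℤ => 2 * k) (Set.range fun k : ℤ => -2 * k - 1) := by
    refine ⟨Set.disjoint_left.mpr ?_, codisjoint_iff.mpr (Set.eq_univ_of_forall fun r => ?_)⟩
    · rintro _ ⟨a, rfl⟩ ⟨b, hb⟩
      simp only at hb
      omega
    · rcases Int.emod_two_eq_zero_or_one r with h | h
      · exact Or.inl ⟨r / 2, by simp only; omega⟩
      · exact Or.inr ⟨-(r / 2) - 1, by simp only; omega⟩
  exact (h1.add_isCompl hc h2).tsum_eq

/-- A theta series in a square root of `-q` splits into two theta series in `q`. -/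
theorem thetaSeries_sqrt_neg {q h : ℂ} (hq0 : q ≠ 0) (hq : ‖q‖ < 1) (hh : h ^ 2 = -q) :
    thetaSeries h (h ^ 3) = thetaSeries (-q ^ 1) (q ^ 6) - q * thetaSeries (-q ^ 5) (q ^ 6) := by
  have hx0 : -q ≠ 0 := neg_ne_zero.mpr hq0
  have h0 : h ≠ 0 := by
    rintro rfl
    exact hq0 (by simpa using hh)
  have hn : ‖h‖ < 1 := by
    have : ‖h‖ ^ 2 < 1 := by rwa [← norm_pow, hh, norm_neg]
    exact (pow_lt_one_iff_of_nonneg (norm_nonneg h) two_ne_zero).mp this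
  have e1 : -q ^ 1 = (-q) ^ 1 := by ring
  have e5 : -q ^ 5 = (-q) ^ 5 := by ring
  have e6 : q ^ 6 = (-q) ^ 6 := by ring
  have hsum := summable_thetaSeries_pow h0 hn 1 three_ne_zero
  rw [e1, e5, e6, thetaSeries_pow hx0, thetaSeries_pow hx0, ← pow_one h, ← pow_mul,
    thetaSeries_pow h0, one_mul, tsum_int_even_add_odd hsum, sub_eq_add_neg, ← neg_mul,
    ← tsum_mul_left]
  congr 1
  · refine tsum_congr fun k => ?_
    rw [← hh, ← zpow_natCast h 2, ← zpow_mul]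
    congr 1; push_cast; ring
  · refine tsum_congr fun k => ?_
    rw [← zpow_one_add₀ hx0, ← hh, ← zpow_natCast h 2, ← zpow_mul]
    congr 1; push_cast; ring

/-- With x = -q the triple product gives (-x, -x^2, x^3; x^3)_∞, that is (-x; x)_∞ (x^3; x^3)_∞ /
(-x^3; x^3)_∞. For m = 1, 3 one has J_m(-q) = J_(2m)^3 / (J_m J_(4m)), which returns everything to
q. Combined with the even-odd splitting, this evaluates J_(5,12) - q J_(1,12) as an eta quotient. -/
theorem thetaSeries_sqrt_neg_eq {q h : ℂ} (hq0 : q ≠ 0) (hq : ‖q‖ < 1) (hh : h ^ 2 = -q) :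
    thetaSeries h (h ^ 3) =
      qJ q 1 * qJ q 4 * qJ q 6 ^ 5 / (qJ q 2 ^ 2 * qJ q 3 ^ 2 * qJ q 12 ^ 2) := by
  have hx : ‖-q‖ < 1 := by rwa [norm_neg]
  have h0 : h ≠ 0 := by
    rintro rfl
    exact hq0 (by simpa using hh)
  have hn : ‖h‖ < 1 := by
    have : ‖h‖ ^ 2 < 1 := by rw [← norm_pow, hh]; exact hx
    exact (pow_lt_one_iff_of_nonneg (norm_nonneg h) two_ne_zero).mp this
  have hj1 : qJ (-q) 1 = qJ q 2 ^ 3 / (qJ q 1 * qJ q 4) := by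
    have h1 := qPochInf_split_two hx (-q)
    have h2 := qPochInf_neg_double hq one_ne_zero
    rw [pow_one, mul_one, mul_one] at h2
    rw [neg_sq, h2, neg_mul_neg, ← pow_two] at h1
    rw [qJ, pow_one, h1, ← qJ]
    ring
  have hj3 : qJ (-q) 3 = qJ q 6 ^ 3 / (qJ q 3 * qJ q 12) := by
    have hx3 : ‖-q ^ 3‖ < 1 := by rw [norm_neg]; exact norm_pow_lt_one hq three_ne_zero
    have h1 := qPochInf_split_two hx3 (-q ^ 3)
    have h2 := qPochInf_neg_double hq three_ne_zero
    rw [neg_sq, ← pow_mul, mul_comm 3 2, h2, neg_mul_neg, ← pow_add] at h1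
    rw [qJ, show (-q) ^ 3 = -q ^ 3 by ring, h1]
    norm_num only
    rw [← qJ]
    ring
  have hj2 : qJ (-q) 2 = qJ q 2 := by rw [qJ, neg_sq, ← qJ]
  have hj6 : qJ (-q) 6 = qJ q 6 := by rw [qJ, show (-q) ^ 6 = q ^ 6 by ring, ← qJ]
  have hs := qPochInf_neg_self hx one_ne_zero
  have hs3 := qPochInf_neg_self hx three_ne_zero
  norm_num only at hs hs3
  rw [pow_one, qPochInf_split_three hx, show - -q * (-q) ^ 2 = -(-q) ^ 3 by ring, hs3, hj1, hj2,
    hj3, hj6] at hs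
  rw [thetaSeries_eq (pow_ne_zero 3 h0) (norm_pow_lt_one hn three_ne_zero) h0,
    show -h * h ^ 3 = - -q * -q by rw [← hh]; ring,
    show -h ^ 3 / h = - -q by rw [← hh]; field_simp,
    show (h ^ 3) ^ 2 = (-q) ^ 3 by rw [← hh]; ring, ← qJ, hj3]
  have n1 := qJ_ne_zero hq one_ne_zero
  have n2 := qJ_ne_zero hq two_ne_zero
  have n3 := qJ_ne_zero hq three_ne_zero
  have n4 := qJ_ne_zero hq four_ne_zero
  have n6 := qJ_ne_zero hq (by norm_num : 6 ≠ 0)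
  have n12 := qJ_ne_zero hq (by norm_num : 12 ≠ 0)
  generalize qPochInf (- -q) ((-q) ^ 3) = A at hs ⊢
  generalize qPochInf (- -q * -q) ((-q) ^ 3) = B at hs ⊢
  field_simp at hs ⊢
  linear_combination hs

/-! ### Evaluations of the quadruple series -/

theorem nahmF_inv_one_one {q : ℂ} (hq0 : q ≠ 0) (hq : ‖q‖ < 1) {u : ℂ} (hu : u ≠ 0) :
    nahmF u u⁻¹ 1 1 q =
      qJ q 2 ^ 3 * (qPochInf (-(q / u)) (q ^ 2) * qPochInf (-(q * u)) (q ^ 2)) *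
          (qPochInf (-(q ^ 2 * u)) (q ^ 4) * qPochInf (-(q ^ 2 / u)) (q ^ 4)) /
          (qJ q 1 ^ 2 * qJ q 4)
        + 2 * q * (qJ q 4 ^ 3 *
            (qPochInf (-u⁻¹) (q ^ 2) * qPochInf (-(q ^ 2 * u)) (q ^ 2)) *
            (qPochInf (-u) (q ^ 4) * qPochInf (-(q ^ 4 / u)) (q ^ 4)) /
            qJ q 2 ^ 3) := by
  have h2 := norm_pow_lt_one hq two_ne_zero
  have h4 := norm_pow_lt_one hq four_ne_zero
  have hq2 := pow_ne_zero 2 hq0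
  have n1 := qJ_ne_zero hq one_ne_zero
  have n2 := qJ_ne_zero hq two_ne_zero
  have n4 := qJ_ne_zero hq four_ne_zero
  have a1 := qPochInf_neg_double hq one_ne_zero
  have a2 := qPochInf_neg_self hq two_ne_zero
  have a0 := qPochInf_neg_one hq two_ne_zero
  norm_num only [pow_one, mul_one] at a1 a2 a0
  have j2 : qPochInf (q ^ 2) (q ^ 2) = qJ q 2 := rfl
  have j4 : qPochInf (q ^ 4) (q ^ 4) = qJ q 4 := rfl
  have e1 : -q ^ 2 / (u * q ^ 2) = -u⁻¹ := by field_simp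
  rw [nahmF_eq_add hq0 hq 1 hu (inv_ne_zero hu) one_ne_zero, nahmHalf_inv_zero hq0 hq hu,
    nahmHalf_inv_one hq0 hq hu, tsum_triple_one_zero hq, tsum_triple_one_one hq0 hq,
    thetaSeries_eq hq2 h2 hu, thetaSeries_eq hq2 h2 (mul_ne_zero hu hq2), e1, ← pow_mul,
    neg_one_mul, a0, a1, a2, j2, qPochInf_succ h2 (-u), qPochInf_succ h2 (-u⁻¹),
    qPochInf_succ h4 (-u), qPochInf_succ h4 (-u⁻¹)]
  norm_num only
  rw [j4, show -u⁻¹ * q = -(q / u) by ring, show -u * q = -(q * u) by ring,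
    show -u * q ^ 2 = -(q ^ 2 * u) by ring, show -q ^ 2 / u = -(q ^ 2 / u) by ring,
    show -(u * q ^ 2) * q ^ 2 = -u * q ^ 4 by ring, show -u⁻¹ * q ^ 4 = -(q ^ 4 / u) by ring]
  field_simp

theorem nahmF_inv_self_self {q : ℂ} (hq0 : q ≠ 0) (hq : ‖q‖ < 1) :
    nahmF q q⁻¹ q 1 q = 2 * (qJ q 4 ^ 9 / (qJ q 2 ^ 7 * qJ q 8 ^ 2))
        + qJ q 2 ^ 7 * qJ q 8 ^ 2 / (qJ q 1 ^ 4 * qJ q 4 ^ 5) := by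
  have n1 := qJ_ne_zero hq one_ne_zero
  have n2 := qJ_ne_zero hq two_ne_zero
  have n4 := qJ_ne_zero hq four_ne_zero
  have n8 := qJ_ne_zero hq (by norm_num : 8 ≠ 0)
  have a1 := qPochInf_neg_double hq one_ne_zero
  have a2 := qPochInf_neg_self hq two_ne_zero
  have a0 := qPochInf_neg_one hq two_ne_zero
  norm_num only [pow_one, mul_one] at a1 a2 a0
  have j2 : qPochInf (q ^ 2) (q ^ 2) = qJ q 2 := rfl
  rw [nahmF_eq_add hq0 hq 1 hq0 (inv_ne_zero hq0) hq0, nahmHalf_inv_zero hq0 hq hq0,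
    nahmHalf_inv_one hq0 hq hq0, tsum_triple_self_zero hq0 hq, tsum_triple_self_one hq0 hq,
    thetaSeries_zero_two hq0 hq, thetaSeries_two_two hq0 hq,
    show -q * q = -q ^ 2 by ring, show -q⁻¹ * q = -1 by field_simp,
    show -q⁻¹ * q ^ 2 = -q by field_simp, a0, a1, a2, j2]
  field_simp

theorem nahmF_one_one_inv {q : ℂ} (hq0 : q ≠ 0) (hq : ‖q‖ < 1) :
    nahmF 1 1 q⁻¹ 1 q = 8 * (qJ q 2 ^ 3 / qJ q 1 ^ 3) := by
  have h2 := norm_pow_lt_one hq two_ne_zero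
  have n1 := qJ_ne_zero hq one_ne_zero
  have n2 := qJ_ne_zero hq two_ne_zero
  have n4 := qJ_ne_zero hq four_ne_zero
  have a1 := qPochInf_neg_double hq one_ne_zero
  have a2 := qPochInf_neg_self hq two_ne_zero
  have a0 := qPochInf_neg_one hq two_ne_zero
  norm_num only [pow_one, mul_one] at a1 a2 a0
  have j2 : qPochInf (q ^ 2) (q ^ 2) = qJ q 2 := rfl
  have a3 : (1 + q) * qPochInf (-q ^ 3) (q ^ 2) = qPochInf (-q) (q ^ 2) := by
    rw [qPochInf_succ h2 (-q), show -q * q ^ 2 = -q ^ 3 by ring, sub_neg_eq_add]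
  rw [a1, mul_comm, ← eq_div_iff (one_add_ne_zero_of_norm hq)] at a3
  have h := nahmF_eq_add hq0 hq 1 one_ne_zero (inv_ne_zero one_ne_zero) (inv_ne_zero hq0)
  rw [nahmHalf_inv_zero hq0 hq one_ne_zero, nahmHalf_inv_one hq0 hq one_ne_zero,
    tsum_triple_inv_zero hq0 hq, tsum_triple_inv_one hq0 hq, thetaSeries_one_two hq0 hq,
    qPochInf_succ h2 (-q⁻¹), show -q⁻¹ * q = -1 by field_simp,
    show -q⁻¹ * q ^ 2 = -q by field_simp, inv_one, neg_one_mul, neg_one_mul, a0, a1, a2, a3,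
    j2] at h
  rw [h]
  have h1 := one_add_ne_zero_of_norm hq
  field_simp
  ring

theorem nahmF_self_inv_one_sqrt {q h : ℂ} (hq0 : q ≠ 0) (hq : ‖q‖ < 1) (hh : h ^ 2 = q) :
    nahmF q q⁻¹ 1 h q = 2 * (qJ q 4 * qJ₂ q 5 12 / qJ q 1 ^ 2)
        + 2 * h * (qJ q 2 ^ 3 * qJ₂ q 2 12 / (qJ q 1 ^ 3 * qJ q 4))
        - 2 * q * (qJ q 4 * qJ₂ q 1 12 / qJ q 1 ^ 2) := by
  have n1 := qJ_ne_zero hq one_ne_zero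
  have n2 := qJ_ne_zero hq two_ne_zero
  have n3 := qJ_ne_zero hq three_ne_zero
  have n4 := qJ_ne_zero hq four_ne_zero
  have n6 := qJ_ne_zero hq (by norm_num : 6 ≠ 0)
  have n12 := qJ_ne_zero hq (by norm_num : 12 ≠ 0)
  have a1 := qPochInf_neg_double hq one_ne_zero
  have a2 := qPochInf_neg_self hq two_ne_zero
  have a0 := qPochInf_neg_one hq two_ne_zero
  norm_num only [pow_one, mul_one] at a1 a2 a0
  have j2 : qPochInf (q ^ 2) (q ^ 2) = qJ q 2 := rfl
  -- The even half comes out as an eta quotient, while the target has J_(5,12) - q J_(1,12). The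
  -- root of -q is auxiliary: it serves only to relate the two and is independent of h.
  obtain ⟨s, hs⟩ : ∃ s : ℂ, s ^ 2 = -q := IsAlgClosed.exists_pow_nat_eq (-q) two_pos
  have key := thetaSeries_sqrt_neg hq0 hq hs
  rw [thetaSeries_sqrt_neg_eq hq0 hq hs,
    ← qJ₂_eq_thetaSeries hq0 hq (by norm_num : 6 ≠ 0) (by norm_num : 5 + 1 = 6),
    ← qJ₂_eq_thetaSeries hq0 hq (by norm_num : 6 ≠ 0) (by norm_num : 1 + 5 = 6)] at key
  norm_num only at key
  rw [← sub_eq_zero] at key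
  rw [nahmF_eq_add hq0 hq h hq0 (inv_ne_zero hq0) one_ne_zero, nahmHalf_self_inv_zero hq0 hq hq0 hh,
    nahmHalf_self_inv_one hq0 hq hq0 hh, tsum_triangular_self_zero hq0 hq,
    tsum_triangular_self_one hq0 hq, thetaSeries_zero_three hq0 hq, thetaSeries_three_three hq0 hq,
    show -q * q = -q ^ 2 by ring, a0, a1, a2, j2, qJ₂_two_twelve hq, ← sub_eq_zero]
  -- The odd halves agree, so the difference of the two sides is this multiple of the vanishing
  -- expression in `key`.
  trans 2 * qJ q 4 / qJ q 1 ^ 2 * 0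
  · rw [← key]
    field_simp
    ring
  · rw [mul_zero]

theorem nahmF_one_one_inv_sqrt {q h : ℂ} (hq0 : q ≠ 0) (hq : ‖q‖ < 1) (hh : h ^ 2 = q) :
    nahmF 1 q⁻¹ 1 h q = 2 * (qJ q 2 ^ 3 * qJ q 6 ^ 2 / (qJ q 1 ^ 3 * qJ q 4 * qJ q 12))
        + 4 * h * (qJ q 3 * qJ q 4 * qJ q 12 / (qJ q 1 ^ 2 * qJ q 6)) := by
  have n1 := qJ_ne_zero hq one_ne_zero
  have n2 := qJ_ne_zero hq two_ne_zero
  have n3 := qJ_ne_zero hq three_ne_zero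
  have n4 := qJ_ne_zero hq four_ne_zero
  have n6 := qJ_ne_zero hq (by norm_num : 6 ≠ 0)
  have n12 := qJ_ne_zero hq (by norm_num : 12 ≠ 0)
  have a1 := qPochInf_neg_double hq one_ne_zero
  have a2 := qPochInf_neg_self hq two_ne_zero
  have a0 := qPochInf_neg_one hq two_ne_zero
  norm_num only [pow_one, mul_one] at a1 a2 a0
  have j2 : qPochInf (q ^ 2) (q ^ 2) = qJ q 2 := rfl
  rw [nahmF_eq_add hq0 hq h one_ne_zero (inv_ne_zero hq0) one_ne_zero,
    nahmHalf_self_inv_zero hq0 hq one_ne_zero hh, nahmHalf_self_inv_one hq0 hq one_ne_zero hh,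
    tsum_triangular_one_zero hq0 hq, tsum_triangular_one_one hq0 hq,
    thetaSeries_one_three hq0 hq, thetaSeries_two_three hq0 hq, neg_one_mul, a0, a1, a2, j2]
  field_simp
  ring

/-! ### Symmetry and rational powers of `q` -/

theorem nahmF_comm_first (u v w t q : ℂ) : nahmF u v w t q = nahmF v u w t q := by
  let e : ℕ × ℕ × ℕ × ℕ ≃ ℕ × ℕ × ℕ × ℕ :=
    ⟨fun n => (n.2.1, n.1, n.2.2), fun n => (n.2.1, n.1, n.2.2), fun _ => rfl, fun _ => rfl⟩
  rw [nahmF, ← e.tsum_eq, nahmF]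
  refine tsum_congr fun ⟨i, j, k, l⟩ => ?_
  rw [show e (i, j, k, l) = (j, i, k, l) from rfl, nahmTerm_eq_qFactInv, nahmTerm_eq_qFactInv,
    show (j : ℤ) ^ 2 + (i : ℤ) ^ 2 + (k : ℤ) ^ 2 + (l : ℤ) ^ 2 - (j : ℤ) * l - (i : ℤ) * l -
      (k : ℤ) * l = (i : ℤ) ^ 2 + (j : ℤ) ^ 2 + (k : ℤ) ^ 2 + (l : ℤ) ^ 2 - (i : ℤ) * l -
      (j : ℤ) * l - (k : ℤ) * l by ring]
  ring

theorem nahmF_comm_second (u v w t q : ℂ) : nahmF u v w t q = nahmF u w v t q := by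
  let e : ℕ × ℕ × ℕ × ℕ ≃ ℕ × ℕ × ℕ × ℕ :=
    ⟨fun n => (n.1, n.2.2.1, n.2.1, n.2.2.2), fun n => (n.1, n.2.2.1, n.2.1, n.2.2.2),
      fun _ => rfl, fun _ => rfl⟩
  rw [nahmF, ← e.tsum_eq, nahmF]
  refine tsum_congr fun ⟨i, j, k, l⟩ => ?_
  rw [show e (i, j, k, l) = (i, k, j, l) from rfl, nahmTerm_eq_qFactInv, nahmTerm_eq_qFactInv,
    show (i : ℤ) ^ 2 + (k : ℤ) ^ 2 + (j : ℤ) ^ 2 + (l : ℤ) ^ 2 - (i : ℤ) * l - (k : ℤ) * l -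
      (j : ℤ) * l = (i : ℤ) ^ 2 + (j : ℤ) ^ 2 + (k : ℤ) ^ 2 + (l : ℤ) ^ 2 - (i : ℤ) * l -
      (j : ℤ) * l - (k : ℤ) * l by ring]
  ring

theorem qPow_ne_zero (τ : ℍ) (r : ℚ) : qPow τ r ≠ 0 := Complex.exp_ne_zero _

theorem qPow_add (τ : ℍ) (r s : ℚ) : qPow τ (r + s) = qPow τ r * qPow τ s := by
  rw [qPow, qPow, qPow, ← Complex.exp_add]
  congr 1
  push_cast
  ring

theorem qPow_neg (τ : ℍ) (r : ℚ) : qPow τ (-r) = (qPow τ r)⁻¹ := by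
  rw [qPow, qPow, ← Complex.exp_neg]
  congr 1
  push_cast
  ring

theorem qPow_natCast (τ : ℍ) (n : ℕ) : qPow τ n = qPow τ 1 ^ n := by
  rw [qPow, qPow, ← Complex.exp_nat_mul]
  congr 1
  push_cast
  ring

theorem norm_qPow_one_lt_one (τ : ℍ) : ‖qPow τ 1‖ < 1 := by
  have h := UpperHalfPlane.norm_exp_two_pi_I_lt_one τ
  rwa [qPow, Rat.cast_one, mul_one]

end

theorem mainTheorem2 (τ : ℍ) (q : ℂ) (hq : q = qPow τ 1) :
    (∀ u v w t : ℂ, Summable (nahmTerm u v w t q)) ∧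
    (∀ b : ℚ,
      nahmF (qPow τ b) (qPow τ (-b)) 1 1 q =
        qJ q 2 ^ 3 *
            (qPochInf (-qPow τ (1 - b)) (q ^ 2) * qPochInf (-qPow τ (1 + b)) (q ^ 2)) *
            (qPochInf (-qPow τ (2 + b)) (q ^ 4) * qPochInf (-qPow τ (2 - b)) (q ^ 4)) /
            (qJ q 1 ^ 2 * qJ q 4)
          + 2 * q *
            (qJ q 4 ^ 3 *
              (qPochInf (-qPow τ (-b)) (q ^ 2) * qPochInf (-qPow τ (2 + b)) (q ^ 2)) *
              (qPochInf (-qPow τ b) (q ^ 4) * qPochInf (-qPow τ (4 - b)) (q ^ 4)) /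
              qJ q 2 ^ 3)) ∧
    nahmF q⁻¹ q q 1 q =
      2 * (qJ q 4 ^ 9 / (qJ q 2 ^ 7 * qJ q 8 ^ 2))
        + qJ q 2 ^ 7 * qJ q 8 ^ 2 / (qJ q 1 ^ 4 * qJ q 4 ^ 5) ∧
    nahmF q q⁻¹ 1 (qPow τ (1 / 2)) q =
      2 * (qJ q 4 * qJ₂ q 5 12 / qJ q 1 ^ 2)
        + 2 * qPow τ (1 / 2) * (qJ q 2 ^ 3 * qJ₂ q 2 12 / (qJ q 1 ^ 3 * qJ q 4))
        - 2 * q * (qJ q 4 * qJ₂ q 1 12 / qJ q 1 ^ 2) ∧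
    nahmF 1 1 q⁻¹ (qPow τ (1 / 2)) q =
      2 * (qJ q 2 ^ 3 * qJ q 6 ^ 2 / (qJ q 1 ^ 3 * qJ q 4 * qJ q 12))
        + 4 * qPow τ (1 / 2) * (qJ q 3 * qJ q 4 * qJ q 12 / (qJ q 1 ^ 2 * qJ q 6)) ∧
    nahmF 1 1 q⁻¹ 1 q = 8 * (qJ q 2 ^ 3 / qJ q 1 ^ 3) := by
  have hq0 : q ≠ 0 := hq ▸ qPow_ne_zero τ 1
  have hlt : ‖q‖ < 1 := hq ▸ norm_qPow_one_lt_one τ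
  have hh : qPow τ (1 / 2) ^ 2 = q := by
    rw [hq, pow_two, ← qPow_add]
    norm_num
  refine ⟨summable_nahmTerm hq0 hlt, fun b => ?_, ?_, nahmF_self_inv_one_sqrt hq0 hlt hh, ?_,
    nahmF_one_one_inv hq0 hlt⟩
  · have hpow (n : ℕ) : qPow τ n = q ^ n := by rw [qPow_natCast, hq]
    have h1 := hpow 1
    have h2 := hpow 2
    have h4 := hpow 4
    norm_num only [Nat.cast_one, Nat.cast_ofNat, pow_one] at h1 h2 h4
    -- All rational powers in the statement are integer powers of q times `qPow τ b` or its inverse,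
    -- so the identity is the one for general nonzero u at u = `qPow τ b`.
    simp only [sub_eq_add_neg, qPow_add, qPow_neg, h1, h2, h4]
    simp only [← div_eq_mul_inv]
    exact nahmF_inv_one_one hq0 hlt (qPow_ne_zero τ b)
  · rw [nahmF_comm_first]
    exact nahmF_inv_self_self hq0 hlt
  · rw [nahmF_comm_second]
    exact nahmF_one_one_inv_sqrt hq0 hlt hh
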